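/- Let $R$ be a complete discrete valuation ring with fraction field $K$, uniformizer $\pi$ and finite residue field $k=R/(\pi)$ of characteristic $p$, and put $N\pi=\#k$. Let $\mathcal{X}\subseteq\mathbb{P}^N_R$ be a closed subscheme which is smooth over $R$ and whose generic fibre $X=\mathcal{X}\times_R\operatorname{Spec}K$ is irreducible of dimension $d$. Let $\phi_R:\mathcal{X}\to\mathcal{X}$ be an $R$-morphism, and write $\mathcal{X}_k=\mathcal{X}\times_R\operatorname{Spec}k$ and $\overline{\phi}:\mathcal{X}_k\to\mathcal{X}_k$ for the special fibre and the induced morphism. Let $P_R\in\mathcal{X}(R)$ be a periodic point of primitive period $n$ for $\phi_R$ (that is, $n$ is the least positive integer with $\phi_R^n(P_R)=P_R$), and let its reduction $\overline{P}\in\mathcal{X}_k(k)$ have primitive period $m$ for $\overline{\phi}$. Let $\mathcal{V}\subseteq\mathcal{X}$ be the scheme-theoretic union of $\{P_R,\phi_R(P_R),\dots,\phi_R^{n-1}(P_R)\}$, i.e. the closed subscheme whose ideal sheaf is the intersection of the ideal sheaves of these sections, and let $\mathcal{V}_k=\mathcal{V}\times_R\operatorname{Spec}k$. The morphism $\phi_R$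 restricts to $\mathcal{V}$, and $\overline{\phi}^{\,m}$ fixes $\overline{P}$, so $\overline{\phi}^{\,m}$ induces $k$-linear endomorphisms of the cotangent spaces ($\mathfrak{m}/\mathfrak{m}^2$ of the local ring at $\overline{P}$) $T^*_{\overline{P}}\mathcal{X}_k$ and $T^*_{\overline{P}}\mathcal{V}_k$. Then either $n=m$, or the following holds. The restriction map $T^*_{\overline{P}}\mathcal{X}_k\to T^*_{\overline{P}}\mathcal{V}_k$ is surjective and commutes with the endomorphisms induced by $\overline{\phi}^{\,m}$, and there are a $k$-subspace $V\subseteq T^*_{\overline{P}}\mathcal{X}_k$, stable under the endomorphism induced by $\overline{\phi}^{\,m}$, a $k$-linear isomorphism $V\cong T^*_{\overline{P}}\mathcal{V}_k$ compatible with the endomorphisms induced by $\overline{\phi}^{\,m}$, and an integer $e\ge 0$ such that $$n=m\,r_V\,p^e,$$ where $r_V$ is the order of the automorphism of $V$ induced by $\overline{\phi}^{\,m}$. Moreover $d'=\dim_k V$ satisfies $d'\le d$ and $$r_V\le (N\pi)^{d'}-1 .$$ -/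

import Mathlib

open CategoryTheory CategoryTheory.Limits AlgebraicGeometry IsLocalRing

universe u

noncomputable section

namespace PeriodicReduction

/-! ### Iterates and primitive periods of points -/

section Dynamics

variable {C : Type*} [Category C]

/-- The `i`-th iterate of an endomorphism. -/
def iter {X : C} (φ : X ⟶ X) (i : ℕ) : X ⟶ X := ((End.of φ) ^ i).asHom

/-- The `T`-valued point `P` is periodic for `φ` with primitive period `n`: `n` is the least
positive integer with `φⁿ(P) = P`. -/
def IsPrimitivePeriod {T X : C} (φ : X ⟶ X) (P : T ⟶ X) (n : ℕ) : Prop :=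
  IsLeast {i : ℕ | 0 < i ∧ P ≫ iter φ i = P} n

theorem iter_zero {X : C} (φ : X ⟶ X) : iter φ 0 = 𝟙 X := rfl

theorem iter_succ {X : C} (φ : X ⟶ X) (i : ℕ) : iter φ (i + 1) = iter φ i ≫ φ :=
  pow_succ' (End.of φ) i

theorem iter_comp_of_comm {X Y : C} {φ : X ⟶ X} {ψ : Y ⟶ Y} {f : X ⟶ Y}
    (h : f ≫ ψ = φ ≫ f) (i : ℕ) : f ≫ iter ψ i = iter φ i ≫ f := by
  induction i with
  | zero => simp [iter_zero]
  | succ i ih => rw [iter_succ, iter_succ, ← Category.assoc, ih, Category.assoc, h,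
      Category.assoc]

end Dynamics

/-! ### Schemes over a ring, their rational points and projective space -/

/-- `Spec A`, as the final object among the `A`-schemes. A morphism `pt A ⟶ Z` of `A`-schemes
is an element of `Z(A)`. -/
abbrev pt (A : Type u) [CommRing A] : Over (Spec (.of A)) := Over.mk (𝟙 (Spec (.of A)))

attribute [local instance] MvPolynomial.gradedAlgebra in
/-- Projective `N`-space over `A`: `Proj A[t₀, …, t_N]` with its structure morphism. -/
def projectiveSpace (A : Type u) [CommRing A] (N : ℕ) : Over (Spec (.of A)) :=
  Over.mk (Proj.toSpecZero (MvPolynomial.homogeneousSubmodule (Fin (N + 1)) A) ≫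
    Spec.map (CommRingCat.ofHom
      (algebraMap A (MvPolynomial.homogeneousSubmodule (Fin (N + 1)) A 0))))

/-! ### Cotangent spaces at rational points -/

section Cotangent

variable {k : Type u} [Field k]

/-- The point of the underlying topological space given by a `k`-rational point. -/
def pointOf {Z : Over (Spec (.of k))} (z : pt k ⟶ Z) : Z.left :=
  z.left (closedPoint k)

/-- The local ring of `Z` at a `k`-rational point. -/
abbrev localRing {Z : Over (Spec (.of k))} (z : pt k ⟶ Z) : CommRingCat.{u} :=
  Z.left.presheaf.stalk (pointOf z)

/-- The structure of a `k`-algebra on the local ring. -/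
def structureHom {Z : Over (Spec (.of k))} (z : pt k ⟶ Z) :
    CommRingCat.of k ⟶ localRing z :=
  (Scheme.ΓSpecIso (.of k)).inv ≫ Z.hom.appTop ≫ Z.left.presheaf.germ ⊤ (pointOf z)
    (TopologicalSpace.Opens.mem_top _)

instance {Z : Over (Spec (.of k))} (z : pt k ⟶ Z) : Algebra k (localRing z) :=
  (structureHom z).hom.toAlgebra

/-- The cotangent space `𝔪 / 𝔪²` of `Z` at a `k`-rational point, as a vector space over `k`. -/
def CotangentAt {Z : Over (Spec (.of k))} (z : pt k ⟶ Z) : Type u :=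
  (maximalIdeal (localRing z)).Cotangent

instance {Z : Over (Spec (.of k))} (z : pt k ⟶ Z) : AddCommGroup (CotangentAt z) :=
  inferInstanceAs (AddCommGroup (maximalIdeal (localRing z)).Cotangent)

instance {Z : Over (Spec (.of k))} (z : pt k ⟶ Z) : Module k (CotangentAt z) :=
  inferInstanceAs (Module k (maximalIdeal (localRing z)).Cotangent)

theorem pointOf_comp {Z Z' : Over (Spec (.of k))} {z : pt k ⟶ Z} {z' : pt k ⟶ Z'}
    (g : Z ⟶ Z') (h : z ≫ g = z') : g.left (pointOf z) = pointOf z' := by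
  subst h; rfl

/-- The homomorphism of local rings at `z' = g(z)` and `z` which a morphism `g` induces. -/
def localHom {Z Z' : Over (Spec (.of k))} {z : pt k ⟶ Z} {z' : pt k ⟶ Z'}
    (g : Z ⟶ Z') (h : z ≫ g = z') : localRing z' ⟶ localRing z :=
  Z'.left.presheaf.stalkSpecializes (specializes_of_eq (pointOf_comp g h)) ≫
    g.left.stalkMap (pointOf z)

theorem structureHom_comp_localHom {Z Z' : Over (Spec (.of k))} {z : pt k ⟶ Z}
    {z' : pt k ⟶ Z'} (g : Z ⟶ Z') (h : z ≫ g = z') :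
    structureHom z' ≫ localHom g h = structureHom z := by
  have e : Z.hom = g.left ≫ Z'.hom := (Over.w g).symm
  have e₁ : Z'.left.presheaf.germ ⊤ (pointOf z') (TopologicalSpace.Opens.mem_top _) ≫
      localHom g h = g.left.appTop ≫
        Z.left.presheaf.germ ⊤ (pointOf z) (TopologicalSpace.Opens.mem_top _) := by
    rw [localHom, TopCat.Presheaf.germ_stalkSpecializes_assoc]
    exact Scheme.Hom.germ_stalkMap _ _ _ _
  rw [structureHom, structureHom, Category.assoc, Category.assoc, e₁, e,
    Scheme.Hom.comp_appTop, Category.assoc]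

/-- The same homomorphism as a homomorphism of `k`-algebras. -/
def localAlgHom {Z Z' : Over (Spec (.of k))} {z : pt k ⟶ Z} {z' : pt k ⟶ Z'}
    (g : Z ⟶ Z') (h : z ≫ g = z') : localRing z' →ₐ[k] localRing z where
  __ := (localHom g h).hom
  commutes' a := congrArg (fun q => q.hom a) (structureHom_comp_localHom g h)

theorem maximalIdeal_le_comap {Z Z' : Over (Spec (.of k))} {z : pt k ⟶ Z} {z' : pt k ⟶ Z'}
    (g : Z ⟶ Z') (h : z ≫ g = z') :
    maximalIdeal (localRing z') ≤ (maximalIdeal (localRing z)).comap (localAlgHom g h) := by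
  have : IsIso (Z'.left.presheaf.stalkSpecializes (specializes_of_eq (pointOf_comp g h))) :=
    (Z'.left.presheaf.stalkCongr (.of_eq (pointOf_comp g h).symm)).isIso_hom
  have : IsLocalHom (localHom g h).hom := by
    rw [localHom, CommRingCat.hom_comp]
    infer_instance
  exact ((local_hom_TFAE (localHom g h).hom).out 0 3).mp this

/-- The linear map `T*_{g(z)} Z' → T*_z Z` (the differential) which a morphism `g` induces
on cotangent spaces. -/
def cotangentMap {Z Z' : Over (Spec (.of k))} {z : pt k ⟶ Z} {z' : pt k ⟶ Z'}
    (g : Z ⟶ Z') (h : z ≫ g = z') : CotangentAt z' →ₗ[k] CotangentAt z :=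
  Ideal.mapCotangent (maximalIdeal (localRing z')) (maximalIdeal (localRing z))
    (localAlgHom g h) (maximalIdeal_le_comap g h)

end Cotangent

/-! ### Generic and special fibres -/

section Fibres

variable (R : Type u) [CommRing R]

/-- The generic fibre `𝒳 ×_R Spec K`. -/
abbrev genericFibre (K : Type u) [Field K] [Algebra R K] :
    Over (Spec (.of R)) ⥤ Over (Spec (.of K)) :=
  Over.pullback (Spec.map (CommRingCat.ofHom (algebraMap R K)))

variable [IsLocalRing R]

/-- The inclusion of the closed point, `Spec k ⟶ Spec R`. -/
abbrev residueSpec : Spec (.of (ResidueField R)) ⟶ Spec (.of R) :=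
  Spec.map (CommRingCat.ofHom (residue R))

/-- The special fibre `𝒳 ×_R Spec k` of an `R`-scheme, and the reduction of an `R`-morphism. -/
abbrev specialFibre : Over (Spec (.of R)) ⥤ Over (Spec (.of (ResidueField R))) :=
  Over.pullback (residueSpec R)

variable {R}

/-- The reduction in `𝒳(k)` of a point in `𝒳(R)`. -/
def reduction {Z : Over (Spec (.of R))} (P : pt R ⟶ Z) :
    pt (ResidueField R) ⟶ (specialFibre R).obj Z :=
  Over.homMk (pullback.lift (residueSpec R ≫ P.left) (𝟙 _) (by
    have := Over.w P
    simp only [Over.mk_hom] at this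
    simp [this])) (pullback.lift_snd _ _ _)

theorem reduction_comp {Z Z' : Over (Spec (.of R))} (P : pt R ⟶ Z) (g : Z ⟶ Z') :
    reduction P ≫ (specialFibre R).map g = reduction (P ≫ g) := by
  ext1
  refine pullback.hom_ext ?_ ?_
  · change (pullback.lift _ _ _ ≫ pullback.lift _ _ _) ≫ _ = pullback.lift _ _ _ ≫ _
    rw [Category.assoc, pullback.lift_fst, pullback.lift_fst, pullback.lift_fst_assoc,
      Category.assoc, Over.comp_left]
  · change (pullback.lift _ _ _ ≫ pullback.lift _ _ _) ≫ _ = pullback.lift _ _ _ ≫ _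
    rw [Category.assoc, pullback.lift_snd, pullback.lift_snd, pullback.lift_snd]

end Fibres

/-! ### The scheme-theoretic union of an orbit -/

section Orbit

variable {R : Type u} [CommRing R]

/-- The ideal sheaf of the scheme-theoretic union of `P, φ(P), …, φⁿ⁻¹(P)`: the intersection of
the ideal sheaves of these sections. -/
def orbitIdeal {Z : Over (Spec (.of R))} (φ : Z ⟶ Z) (P : pt R ⟶ Z) (n : ℕ) :
    Z.left.IdealSheafData :=
  ⨅ i : Fin n, (P ≫ iter φ i).left.ker

/-- The scheme-theoretic union of `P, φ(P), …, φⁿ⁻¹(P)`. -/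
def orbitUnion {Z : Over (Spec (.of R))} (φ : Z ⟶ Z) (P : pt R ⟶ Z) (n : ℕ) :
    Over (Spec (.of R)) :=
  Over.mk ((orbitIdeal φ P n).subschemeι ≫ Z.hom)

/-- The closed immersion of the scheme-theoretic union. -/
def orbitUnionι {Z : Over (Spec (.of R))} (φ : Z ⟶ Z) (P : pt R ⟶ Z) (n : ℕ) :
    orbitUnion φ P n ⟶ Z :=
  Over.homMk (orbitIdeal φ P n).subschemeι rfl

variable {Z : Over (Spec (.of R))} {φ : Z ⟶ Z} {P : pt R ⟶ Z} {n : ℕ}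

theorem orbitIdeal_le_map (h : IsPrimitivePeriod φ P n) :
    orbitIdeal φ P n ≤ (orbitIdeal φ P n).map φ.left := by
  have hn : 0 < n := h.1.1
  have : (orbitIdeal φ P n).map φ.left = ⨅ i : Fin n, (P ≫ iter φ (i + 1)).left.ker := by
    rw [orbitIdeal, (Scheme.IdealSheafData.map_gc φ.left).u_iInf]
    simp only [Scheme.IdealSheafData.map_ker, iter_succ]
    simp
  rw [this]
  refine le_iInf fun i => ?_
  by_cases hi : (i : ℕ) + 1 < n
  · exact iInf_le (fun j : Fin n => (P ≫ iter φ j).left.ker) ⟨i + 1, hi⟩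
  · have hi' : (i : ℕ) + 1 = n := by omega
    have e : P ≫ iter φ ((i : ℕ) + 1) = P ≫ iter φ ((⟨0, hn⟩ : Fin n) : ℕ) := by
      rw [hi', h.1.2, iter_zero, Category.comp_id]
    rw [e]
    exact iInf_le (fun j : Fin n => (P ≫ iter φ j).left.ker) ⟨0, hn⟩

/-- The restriction of `φ` to the scheme-theoretic union of the orbit. -/
def orbitUnionMap (h : IsPrimitivePeriod φ P n) : orbitUnion φ P n ⟶ orbitUnion φ P n :=
  Over.homMk (Scheme.IdealSheafData.subschemeMap _ _ φ.left (orbitIdeal_le_map h)) (by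
    simp [orbitUnion])

theorem orbitUnionι_comp (h : IsPrimitivePeriod φ P n) :
    orbitUnionι φ P n ≫ φ = orbitUnionMap h ≫ orbitUnionι φ P n := by
  ext1
  exact (Scheme.IdealSheafData.subschemeMap_subschemeι _ _ φ.left (orbitIdeal_le_map h)).symm

theorem orbitIdeal_le_ker (h : IsPrimitivePeriod φ P n) :
    (orbitIdeal φ P n).subschemeι.ker ≤ P.left.ker := by
  have hn : 0 < n := h.1.1
  rw [Scheme.IdealSheafData.ker_subschemeι]
  refine (iInf_le (fun j : Fin n => (P ≫ iter φ j).left.ker) ⟨0, hn⟩).trans ?_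
  simp [iter_zero]

/-- The factorisation of `P` through the scheme-theoretic union of its orbit. -/
def orbitUnionLift (h : IsPrimitivePeriod φ P n) :
    Spec (.of R) ⟶ (orbitIdeal φ P n).subscheme :=
  IsClosedImmersion.lift (orbitIdeal φ P n).subschemeι P.left (orbitIdeal_le_ker h)

theorem orbitUnionLift_fac (h : IsPrimitivePeriod φ P n) :
    orbitUnionLift h ≫ (orbitIdeal φ P n).subschemeι = P.left :=
  IsClosedImmersion.lift_fac _ _ _

/-- The point `P`, as a point of the scheme-theoretic union of its orbit. -/
def orbitUnionPoint (h : IsPrimitivePeriod φ P n) : pt R ⟶ orbitUnion φ P n :=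
  Over.homMk (orbitUnionLift h) (by
    change orbitUnionLift h ≫ (orbitIdeal φ P n).subschemeι ≫ Z.hom = _
    rw [← Category.assoc, orbitUnionLift_fac]
    exact Over.w P)

theorem orbitUnionPoint_comp (h : IsPrimitivePeriod φ P n) :
    orbitUnionPoint h ≫ orbitUnionι φ P n = P := by
  ext1
  exact orbitUnionLift_fac h

variable [IsLocalRing R]

theorem reduction_orbitUnionPoint_comp (h : IsPrimitivePeriod φ P n) :
    reduction (orbitUnionPoint h) ≫ (specialFibre R).map (orbitUnionι φ P n) = reduction P := by
  rw [reduction_comp, orbitUnionPoint_comp]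

instance : Mono ((specialFibre R).map (orbitUnionι φ P n)) := by
  have : Mono (orbitUnionι φ P n).left :=
    inferInstanceAs (Mono (orbitIdeal φ P n).subschemeι)
  have : Mono (orbitUnionι φ P n) := Over.mono_of_mono_left _
  infer_instance

theorem reduction_orbitUnionPoint_iter (h : IsPrimitivePeriod φ P n) {m : ℕ}
    (hm : IsPrimitivePeriod ((specialFibre R).map φ) (reduction P) m) :
    reduction (orbitUnionPoint h) ≫ iter ((specialFibre R).map (orbitUnionMap h)) m =
      reduction (orbitUnionPoint h) := by
  have c : (specialFibre R).map (orbitUnionι φ P n) ≫ (specialFibre R).map φ =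
      (specialFibre R).map (orbitUnionMap h) ≫ (specialFibre R).map (orbitUnionι φ P n) := by
    rw [← Functor.map_comp, ← Functor.map_comp, orbitUnionι_comp h]
  rw [← cancel_mono ((specialFibre R).map (orbitUnionι φ P n)), Category.assoc,
    ← iter_comp_of_comm c m, ← Category.assoc, reduction_orbitUnionPoint_comp, hm.1.2]

/-- The map `T*_P̄ 𝒵_k → T*_P̄ 𝒱_k` which the inclusion of the scheme-theoretic union `𝒱` of the
orbit of `P` induces. -/
def orbitRestriction (h : IsPrimitivePeriod φ P n) :
    CotangentAt (reduction P) →ₗ[ResidueField R] CotangentAt (reduction (orbitUnionPoint h)) :=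
  cotangentMap ((specialFibre R).map (orbitUnionι φ P n)) (reduction_orbitUnionPoint_comp h)

/-- The endomorphism of `T*_P̄ 𝒵_k` induced by the `m`-th iterate of the reduction of `φ`, where
`m` is the primitive period of the reduction `P̄` of `P`. -/
def reducedDifferential {m : ℕ}
    (hm : IsPrimitivePeriod ((specialFibre R).map φ) (reduction P) m) :
    Module.End (ResidueField R) (CotangentAt (reduction P)) :=
  cotangentMap (iter ((specialFibre R).map φ) m) hm.1.2

/-- The endomorphism of `T*_P̄ 𝒱_k` induced by the `m`-th iterate of the reduction of `φ`, for
the scheme-theoretic union `𝒱` of the orbit of `P`. -/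
def orbitDifferential {m : ℕ} (h : IsPrimitivePeriod φ P n)
    (hm : IsPrimitivePeriod ((specialFibre R).map φ) (reduction P) m) :
    Module.End (ResidueField R) (CotangentAt (reduction (orbitUnionPoint h))) :=
  cotangentMap (iter ((specialFibre R).map (orbitUnionMap h)) m)
    (reduction_orbitUnionPoint_iter h hm)

end Orbit

end PeriodicReduction

end

open PeriodicReduction

/-!
The period of `P` is computed on the scheme-theoretic union `𝒱` of its orbit. Let `s = n / m`, put
`Ψ = φ ^ m` and let `C` be the local ring of `𝒱` at the reduction of `P`, on which `Ψ` acts by `σ`.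
The points of the orbit in the residue class of `P` are the `s` points `Ψ ^ i (P)`. Since sections
of a separated scheme are closed, the other points of the orbit can be avoided, and an element of
`C` vanishes as soon as it vanishes at these `s` points (`eq_zero_of_forall_evalAt_eq_zero`). So
`C` embeds into `R ^ s`, and it is a finite `R`-module on which `σ` has order `s`.

Let `A = C / 𝔪_R C` be the local ring of the special fibre of `𝒱`, and let `r` be the order of the
endomorphism of `𝔪_A / 𝔪_A ^ 2` which `σ` induces; it divides `s`. Write `s = r p ^ a t` with `p`
not dividing `t`. The automorphism `ρ = σ ^ (r p ^ a)` satisfies `ρ ^ t = 1` and is trivial on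
`𝔪_A / 𝔪_A ^ 2`. If `ρ - 1` maps a module into `N` and `N` into a smaller `N'`, then
`0 = ρ ^ t - 1 = t (ρ - 1)` modulo `N'`, and `t` is invertible, so `ρ - 1` maps the module into `N'`
(`sub_mem_of_pow_eq_one`). Applied to the powers of `𝔪_A`, and then to the powers of `𝔪_R` on `C`,
this and Krull's intersection theorem show that `ρ` is trivial on `A` and on `C`. Hence `t = 1`, and
`s = r p ^ a` (`period_eq_orderOf_mapCotangent_mul_pow`). If the cotangent space vanishes, `A` is
the residue field, `C` is generated by `1` over `R` by Nakayama's lemma, and `s = 1`.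

The restriction of cotangent vectors to `𝒱` presents the cotangent space of `𝒱` as an equivariant
quotient of that of the special fibre. An equivariant quotient of a finite-dimensional vector space
with an endomorphism is isomorphic to a stable subspace, as an endomorphism is conjugate to its
transpose (`exists_stable_submodule_equiv_quotient`). The bound on the order holds as the powers of
an automorphism of a `d'`-dimensional space are nonzero elements of a space of dimension at most
`d'`, by the Cayley–Hamilton theorem (`orderOf_end_le`).

Finally, a neighbourhood of the reduction of `P` is standard smooth over `R` of some relative
dimension `δ`. The cotangent space of the special fibre is a quotient of the fibre of the module of
differentials, so it has dimension at most `δ` (`finrank_cotangentAt_reduction_le`). The generic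
fibre has dimension at least `δ` by Krull's height theorem at the rational point given by `P`
(`le_topologicalKrullDim_genericFibre`).
-/

namespace PeriodicReduction

/-! ### Endomorphisms of finite-dimensional vector spaces -/

section LinearAlgebra

variable {k : Type*} [Field k]

open Polynomial in
/-- `k[X]/(g)` is a Frobenius algebra: the coefficient of `X ^ (deg g - 1)` of the reduced
representative is a linear form whose kernel contains no nonzero ideal. -/
theorem exists_linearForm_quotient_span {g : k[X]} (hg : g ≠ 0) :
    ∃ l : (k[X] ⧸ Submodule.span k[X] {g}) →ₗ[k] k,
      ∀ h : k[X], (∀ y : k[X], l (Submodule.Quotient.mk (h * y)) = 0) →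
        (Submodule.Quotient.mk h : k[X] ⧸ Submodule.span k[X] {g}) = 0 := by
  set d := g.natDegree with hd
  let l₀ : k[X] →ₗ[k] k :=
    { toFun := fun h => (h % g).coeff (d - 1)
      map_add' := fun a b => by simp [Polynomial.add_mod]
      map_smul' := fun c a => by
        rw [← Polynomial.C_mul', Polynomial.mod_def, Polynomial.mod_def, Polynomial.C_mul',
          Polynomial.smul_modByMonic]
        simp }
  have hl₀ : (Submodule.span k[X] {g}).restrictScalars k ≤ LinearMap.ker l₀ := by
    intro x hx
    obtain ⟨y, rfl⟩ := Submodule.mem_span_singleton.mp hx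
    have : y • g % g = 0 := by
      rw [smul_eq_mul, EuclideanDomain.mod_eq_zero]; exact dvd_mul_left g y
    change (y • g % g).coeff (d - 1) = 0
    rw [this, Polynomial.coeff_zero]
  let l := (((Submodule.span k[X] {g}).restrictScalars k).liftQ l₀ hl₀) ∘ₗ
    (Submodule.Quotient.restrictScalarsEquiv k (Submodule.span k[X] {g})).symm.toLinearMap
  have hl : ∀ h : k[X], l (Submodule.Quotient.mk h) = (h % g).coeff (d - 1) := fun h => rfl
  have hmod : ∀ h : k[X], g ∣ h - h % g := fun h => by
    exact ⟨h / g, by rw [sub_eq_iff_eq_add, EuclideanDomain.div_add_mod]⟩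
  refine ⟨l, fun h H => ?_⟩
  rw [Submodule.Quotient.mk_eq_zero, Submodule.mem_span_singleton]
  by_cases hr : h % g = 0
  · obtain ⟨q, hq⟩ := EuclideanDomain.mod_eq_zero.mp hr
    exact ⟨q, by rw [hq, smul_eq_mul, mul_comm]⟩
  exfalso
  set r := h % g with hr'
  have hlt : r.natDegree < d :=
    Polynomial.natDegree_lt_natDegree hr (EuclideanDomain.mod_lt h hg)
  have h1 := H (X ^ (d - 1 - r.natDegree))
  rw [hl] at h1
  have h2 : h * X ^ (d - 1 - r.natDegree) % g = r * X ^ (d - 1 - r.natDegree) := by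
    have h3 : (r * X ^ (d - 1 - r.natDegree)) % g = r * X ^ (d - 1 - r.natDegree) := by
      rw [Polynomial.mod_eq_self_iff hg, Polynomial.degree_mul, Polynomial.degree_X_pow,
        Polynomial.degree_eq_natDegree hr, Polynomial.degree_eq_natDegree hg]
      norm_cast; omega
    rw [← h3, ← sub_eq_zero, ← Polynomial.sub_mod, EuclideanDomain.mod_eq_zero, ← sub_mul]
    exact (hmod h).mul_right _
  rw [h2, show d - 1 = r.natDegree + (d - 1 - r.natDegree) by omega] at h1
  simp only [Nat.add_sub_cancel_left] at h1
  rw [Polynomial.coeff_mul_X_pow] at h1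
  exact hr (Polynomial.leadingCoeff_eq_zero.mp h1)

open Polynomial in
/-- Every endomorphism of a finite-dimensional vector space is self-adjoint for some
nondegenerate bilinear form; equivalently, it is conjugate to its transpose. -/
theorem exists_injective_dual_selfAdjoint {N : Type*} [AddCommGroup N] [Module k N]
    [FiniteDimensional k N] (f : Module.End k N) :
    ∃ B : N →ₗ[k] Module.Dual k N, Function.Injective B ∧ ∀ x y, B (f x) y = B x (f y) := by
  classical
  have : FiniteDimensional k (Module.End k N) := inferInstance
  obtain ⟨ι, _, p, hp, e, ⟨E⟩⟩ := Module.equiv_directSum_of_isTorsion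
    (Module.AEval.isTorsion_of_finiteDimensional k N f)
  choose l hl using fun i => exists_linearForm_quotient_span (pow_ne_zero (e i) (hp i).ne_zero)
  let E' : N →ₗ[k] (DirectSum ι fun i => k[X] ⧸ Submodule.span k[X] {p i ^ e i}) :=
    (E.restrictScalars k).toLinearMap ∘ₗ (Module.AEval.of k N f).toLinearMap
  have hE' : ∀ x, E' (f x) = (X : k[X]) • E' x := fun x => by
    change E (Module.AEval.of k N f (f x)) = X • E (Module.AEval.of k N f x)
    rw [← map_smul, Module.AEval.X_smul_of]; rfl
  have hEi : Function.Injective E' := E.injective.comp (Module.AEval.of k N f).injective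
  have hEs : Function.Surjective E' := E.surjective.comp (Module.AEval.of k N f).surjective
  let m (i) : (k[X] ⧸ Submodule.span k[X] {p i ^ e i}) →ₗ[k]
      (k[X] ⧸ Submodule.span k[X] {p i ^ e i}) →ₗ[k] (k[X] ⧸ Submodule.span k[X] {p i ^ e i}) :=
    LinearMap.mul k (k[X] ⧸ Ideal.span {p i ^ e i})
  let c (i) : (DirectSum ι fun i => k[X] ⧸ Submodule.span k[X] {p i ^ e i}) →ₗ[k]
      (k[X] ⧸ Submodule.span k[X] {p i ^ e i}) := DirectSum.component k ι _ i
  let B : N →ₗ[k] N →ₗ[k] k :=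
    ∑ i, ((m i).compl₁₂ (c i ∘ₗ E') (c i ∘ₗ E')).compr₂ (l i)
  have hB : ∀ x y, B x y = ∑ i, l i (m i (E' x i) (E' y i)) := fun x y => by
    simp [B, c, LinearMap.sum_apply, DirectSum.component]
    rfl
  have hm : ∀ (i) (a b : k[X]), m i (Submodule.Quotient.mk a) (Submodule.Quotient.mk b) =
    Submodule.Quotient.mk (a * b) := fun i a b => rfl
  refine ⟨B, ?_, fun x y => ?_⟩
  · rw [injective_iff_map_eq_zero]
    intro x hx
    apply hEi
    rw [map_zero]
    ext i
    obtain ⟨h, hh⟩ := Submodule.Quotient.mk_surjective _ (E' x i)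
    rw [← hh]
    refine hl i h fun y => ?_
    obtain ⟨z, hz⟩ := hEs (DirectSum.of _ i (Submodule.Quotient.mk y))
    have h1 := hB x z
    rw [hx, LinearMap.zero_apply, Finset.sum_eq_single i, hz, DirectSum.of_eq_same, ← hh, hm] at h1
    · exact h1.symm
    · intro j _ hj
      rw [hz, DirectSum.of_eq_of_ne _ _ _ hj, map_zero, map_zero]
    · simp
  · rw [hB, hB]
    refine Finset.sum_congr rfl fun i _ => ?_
    rw [hE', hE', DirectSum.smul_apply, DirectSum.smul_apply]
    obtain ⟨a, ha⟩ := Submodule.Quotient.mk_surjective _ (E' x i)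
    obtain ⟨b, hb⟩ := Submodule.Quotient.mk_surjective _ (E' y i)
    rw [← ha, ← hb, ← Submodule.Quotient.mk_smul, ← Submodule.Quotient.mk_smul, hm, hm,
      smul_eq_mul, smul_eq_mul]
    congr 2
    ring

/-- A quotient of a finite-dimensional vector space with an endomorphism is isomorphic to a
stable subspace: dualise, and use that each endomorphism is conjugate to its transpose. -/
theorem exists_stable_submodule_equiv_quotient {M Q : Type*} [AddCommGroup M] [Module k M]
    [FiniteDimensional k M] [AddCommGroup Q] [Module k Q] (f : Module.End k M)
    (g : Module.End k Q) (π : M →ₗ[k] Q) (hπ : Function.Surjective π) (h : π ∘ₗ f = g ∘ₗ π) :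
    ∃ (V : Submodule k M) (hV : ∀ v ∈ V, f v ∈ V) (θ : V ≃ₗ[k] Q),
      ∀ v, θ (f.restrict hV v) = g (θ v) := by
  have : FiniteDimensional k Q := Module.Finite.of_surjective π hπ
  obtain ⟨B, hBi, hB⟩ := exists_injective_dual_selfAdjoint f
  obtain ⟨B', hBi', hB'⟩ := exists_injective_dual_selfAdjoint g
  let β := LinearEquiv.ofInjectiveOfFinrankEq B hBi (Subspace.dual_finrank_eq).symm
  have hβ : ∀ x, β x = B x := fun x => rfl
  let i : Q →ₗ[k] M := β.symm.toLinearMap ∘ₗ π.dualMap ∘ₗ B'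
  have hi : ∀ q y, B (i q) y = B' q (π y) := fun q y => by
    rw [← hβ, show β (i q) = π.dualMap (B' q) from β.apply_symm_apply _]; rfl
  have hinj : Function.Injective i := by
    rw [injective_iff_map_eq_zero]
    intro q hq
    apply hBi'
    ext y
    obtain ⟨x, rfl⟩ := hπ y
    rw [← hi, hq]; simp
  have hfi : ∀ q, f (i q) = i (g q) := fun q => by
    apply hBi
    ext y
    rw [hB, hi, hi, hB']
    exact congrArg (B' q) (LinearMap.congr_fun h y)
  let θ := LinearEquiv.ofInjective i hinj
  have hV : ∀ v ∈ LinearMap.range i, f v ∈ LinearMap.range i := by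
    rintro _ ⟨q, rfl⟩
    exact ⟨g q, (hfi q).symm⟩
  refine ⟨LinearMap.range i, hV, θ.symm, fun v => ?_⟩
  obtain ⟨q, rfl⟩ := θ.surjective v
  rw [θ.symm_apply_apply, LinearEquiv.symm_apply_eq]
  exact Subtype.ext (hfi q)

theorem orderOf_eq_of_linearEquiv {V W : Type*} [AddCommGroup V] [Module k V] [AddCommGroup W]
    [Module k W] (θ : V ≃ₗ[k] W) {f : Module.End k V} {g : Module.End k W}
    (h : ∀ v, θ (f v) = g (θ v)) : orderOf f = orderOf g := by
  have : g = θ.conjRingEquiv f := by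
    ext w
    obtain ⟨v, rfl⟩ := θ.surjective w
    simp [h]
  rw [this]
  exact (orderOf_injective θ.conjRingEquiv.toMonoidHom θ.conjRingEquiv.injective f).symm

open Polynomial in
/-- By the Cayley–Hamilton theorem the powers of `T` are nonzero elements of a space of dimension
at most that of `M`, the space of polynomials in `T` of degree below `dim M`. -/
theorem orderOf_end_le [Finite k] {M : Type*} [AddCommGroup M] [Module k M]
    [FiniteDimensional k M] [Nontrivial M] (T : Module.End k M) (hT : 0 < orderOf T) :
    orderOf T ≤ Nat.card k ^ Module.finrank k M - 1 := by
  classical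
  have : FiniteDimensional k (degreeLT k (Module.finrank k M)) :=
    Module.Finite.equiv (degreeLTEquiv k (Module.finrank k M)).symm
  let W := (degreeLT k (Module.finrank k M)).map (aeval T).toLinearMap
  have hfin : Module.finrank k W ≤ Module.finrank k M := by
    refine (Submodule.finrank_map_le _ _).trans ?_
    rw [(degreeLTEquiv k (Module.finrank k M)).finrank_eq, Module.finrank_fin_fun]
  have hW : ∀ i, T ^ i ∈ W := fun i => by
    refine ⟨X ^ i %ₘ T.charpoly, ?_, ?_⟩
    · rw [SetLike.mem_coe, mem_degreeLT, ← LinearMap.charpoly_natDegree T,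
        ← Polynomial.degree_eq_natDegree (LinearMap.charpoly_monic T).ne_zero]
      exact degree_modByMonic_lt _ (LinearMap.charpoly_monic T)
    · have := congrArg (aeval T) (modByMonic_add_div (X ^ i) T.charpoly)
      rw [map_add, map_mul, LinearMap.aeval_self_charpoly, zero_mul, add_zero] at this
      simpa using this
  have : Finite W := Module.finite_of_finite k
  have : Fintype W := Fintype.ofFinite W
  have hu : IsUnit T := IsUnit.of_pow_eq_one (pow_orderOf_eq_one T) (by omega)
  have hcard : orderOf T ≤ ((Finset.univ : Finset W).erase 0).card := by
    rw [← Finset.card_range (orderOf T), ← Finset.card_image_of_injOn (s := Finset.range _)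
      (f := fun i => (⟨T ^ i, hW i⟩ : W)) (by
        intro i hi j hj h
        simp only [Finset.coe_range] at hi hj
        exact pow_injOn_Iio_orderOf hi hj (congrArg Subtype.val h))]
    refine Finset.card_le_card fun x hx => ?_
    obtain ⟨i, -, rfl⟩ := Finset.mem_image.mp hx
    refine Finset.mem_erase.mpr ⟨fun h => (hu.pow i).ne_zero ?_, Finset.mem_univ _⟩
    exact congrArg Subtype.val h
  rw [Finset.card_erase_of_mem (Finset.mem_univ _), Finset.card_univ, ← Nat.card_eq_fintype_card,
    Module.natCard_eq_pow_finrank (K := k)] at hcard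
  have : Nat.card k ^ Module.finrank k W ≤ Nat.card k ^ Module.finrank k M :=
    Nat.pow_le_pow_right Nat.card_pos hfin
  omega

end LinearAlgebra

/-! ### Periods of automorphisms of local rings -/

section LocalPeriod

/-- If `ρ ^ t = 1` with `t` invertible and `ρ - 1` maps everything into `N` and `N` into `N'`, then
it maps everything into `N'`: modulo `N'` one has `0 = ρ ^ t - 1 = t (ρ - 1)`. -/
theorem sub_mem_of_pow_eq_one {R M : Type*} [CommRing R] [AddCommGroup M] [Module R M]
    {ρ : Module.End R M} {t : ℕ} (ht : ρ ^ t = 1) (hu : IsUnit (t : R)) {N N' : Submodule R M}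
    (h₁ : ∀ x, ρ x - x ∈ N) (h₂ : ∀ x ∈ N, ρ x - x ∈ N') (x : M) : ρ x - x ∈ N' := by
  have a : ∀ j : ℕ, (ρ ^ j) x - x ∈ N := fun j => by
    induction j with
    | zero => simp
    | succ j ih =>
      rw [pow_succ', Module.End.mul_apply]
      have := N.add_mem (h₁ ((ρ ^ j) x)) ih
      rwa [sub_add_sub_cancel] at this
  have b : ∀ j : ℕ, (ρ ^ j) x - x - (j : R) • (ρ x - x) ∈ N' := fun j => by
    induction j with
    | zero => simp
    | succ j ih =>
      have := N'.add_mem (h₂ _ (a j)) ih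
      convert this using 1
      rw [pow_succ', Module.End.mul_apply, map_sub, Nat.cast_add, Nat.cast_one, add_smul, one_smul]
      abel
  have c := b t
  rw [ht, Module.End.one_apply, sub_self, zero_sub, N'.neg_mem_iff] at c
  exact (N'.smul_mem_iff_of_isUnit hu).mp c

/-- An automorphism of order prime to the residue characteristic that is trivial modulo the
maximal ideal is trivial. -/
theorem eq_one_of_sub_mem_maximalIdeal_smul {R M : Type*} [CommRing R] [IsLocalRing R]
    [IsNoetherianRing R] [AddCommGroup M] [Module R M] [Module.Finite R M]
    {ρ : Module.End R M} {t : ℕ} (ht : ρ ^ t = 1) (hu : IsUnit (t : R))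
    (h : ∀ x, ρ x - x ∈ maximalIdeal R • (⊤ : Submodule R M)) : ρ = 1 := by
  have key : ∀ i : ℕ, ∀ x, ρ x - x ∈ maximalIdeal R ^ i • (⊤ : Submodule R M) := fun i => by
    induction i with
    | zero => intro x; simp
    | succ i ih =>
      refine sub_mem_of_pow_eq_one ht hu ih fun x hx => ?_
      refine Submodule.smul_induction_on hx (fun r hr y _ => ?_) fun y z hy hz => ?_
      · rw [map_smul, ← smul_sub, pow_succ, Submodule.mul_smul]
        exact Submodule.smul_mem_smul hr (h y)
      · rw [map_add, add_sub_add_comm]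
        exact Submodule.add_mem _ hy hz
  ext x
  rw [Module.End.one_apply, ← sub_eq_zero, ← Submodule.mem_bot R,
    ← Ideal.iInf_pow_smul_eq_bot_of_isLocalRing (maximalIdeal R) (M := M)
      (IsLocalRing.maximalIdeal.isMaximal R).ne_top]
  exact Submodule.mem_iInf _ |>.mpr fun i => key i x

/-- An automorphism of a local `k`-algebra with residue field `k` whose order is prime to the
characteristic of `k` is trivial if it is trivial on the cotangent space. -/
theorem apply_eq_self_of_sub_mem_sq {k A : Type*} [Field k] [CommRing A] [IsLocalRing A]
    [IsNoetherianRing A] [Algebra k A]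
    (hA : ∀ a : A, ∃ c : k, a - algebraMap k A c ∈ maximalIdeal A)
    {ρ : A →ₐ[k] A} {t : ℕ} (ht : ρ ^ t = 1) (hu : IsUnit (t : k))
    (hm : ∀ x ∈ maximalIdeal A, ρ x ∈ maximalIdeal A)
    (h : ∀ x ∈ maximalIdeal A, ρ x - x ∈ maximalIdeal A ^ 2) (a : A) : ρ a = a := by
  have hpow : ∀ i : ℕ, ∀ x ∈ maximalIdeal A ^ i, ρ x ∈ maximalIdeal A ^ i := fun i x hx => by
    have h1 : maximalIdeal A ^ i ≤ (maximalIdeal A ^ i).comap ρ := by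
      rw [← Ideal.map_le_iff_le_comap, Ideal.map_pow]
      exact Ideal.pow_right_mono (Ideal.map_le_iff_le_comap.mpr hm) i
    exact h1 hx
  have hstep : ∀ i : ℕ, ∀ x ∈ maximalIdeal A ^ (i + 1),
      ρ x - x ∈ maximalIdeal A ^ (i + 2) := fun i => by
    induction i with
    | zero => intro x hx; exact h x (by simpa using hx)
    | succ i ih =>
      intro x hx
      rw [pow_succ] at hx
      refine Submodule.mul_induction_on hx (fun y hy z hz => ?_) fun y z hy hz => ?_
      · have e : ρ (y * z) - y * z = ρ y * (ρ z - z) + (ρ y - y) * z := by rw [map_mul]; ring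
        rw [e]
        refine Ideal.add_mem _ ?_ ?_
        · rw [show i + 1 + 2 = (i + 1) + 2 from rfl, pow_add]
          exact Ideal.mul_mem_mul (hpow _ _ hy) (h z hz)
        · rw [show i + 1 + 2 = (i + 2) + 1 from rfl, pow_succ]
          exact Ideal.mul_mem_mul (ih y hy) hz
      · rw [map_add, add_sub_add_comm]
        exact Ideal.add_mem _ hy hz
  have hD : ∀ a : A, ρ a - a ∈ maximalIdeal A := fun a => by
    obtain ⟨c, hc⟩ := hA a
    have := Ideal.sub_mem _ (hm _ hc) hc
    simpa using this
  have ht' : ρ.toLinearMap ^ t = 1 := by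
    ext x
    have := congrArg (fun f : A →ₐ[k] A => f x) ht
    simpa [Module.End.pow_apply, AlgHom.coe_pow] using this
  have key : ∀ i : ℕ, ∀ x, ρ x - x ∈ maximalIdeal A ^ (i + 1) := fun i => by
    induction i with
    | zero => intro x; simpa using hD x
    | succ i ih =>
      exact sub_mem_of_pow_eq_one ht' hu (N := (maximalIdeal A ^ (i + 1)).restrictScalars k)
        (N' := (maximalIdeal A ^ (i + 2)).restrictScalars k) ih (hstep i)
  rw [← sub_eq_zero, ← Ideal.mem_bot, ← Ideal.iInf_pow_eq_bot_of_isLocalRing (maximalIdeal A)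
    (IsLocalRing.maximalIdeal.isMaximal A).ne_top]
  exact (Submodule.mem_iInf _).mpr fun i => Ideal.pow_le_pow_right (Nat.le_succ i) (key i a)

theorem mapCotangent_pow_toCotangent {k A : Type*} [CommRing k] [CommRing A] [Algebra k A]
    (I : Ideal A) (τ : A →ₐ[k] A) (h : I ≤ I.comap τ) (i : ℕ) (x : I) :
    ∃ hx : (τ ^ i) x ∈ I, ((I.mapCotangent I τ h : Module.End k I.Cotangent) ^ i)
      (I.toCotangent x) = I.toCotangent ⟨(τ ^ i) x, hx⟩ := by
  induction i with
  | zero => exact ⟨x.2, rfl⟩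
  | succ i ih =>
    obtain ⟨hx, e⟩ := ih
    refine ⟨?_, ?_⟩
    · rw [pow_succ', AlgHom.mul_apply]; exact h hx
    · rw [pow_succ', Module.End.mul_apply, e, Ideal.mapCotangent_toCotangent]
      exact congrArg _ (Subtype.ext (DFunLike.congr_fun (pow_succ' τ i) x.1).symm)

/-- Let `C` be a local `R`-algebra with an endomorphism `σ` and a point `ev : C → R` such that the
points `ev ∘ σ ^ i` separate the elements of `C`, and let `s` be the primitive period of `ev`.
If `A` is the special fibre of `C`, then `s` is the product of the order of the endomorphism of
the cotangent space of `A` and a power of the residue characteristic `p`; and `s = 1` if the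
cotangent space vanishes. The special fibre enters as a surjection `q : C → A` whose kernel is
generated by the maximal ideal of `R`. -/
theorem period_eq_orderOf_mapCotangent_mul_pow {R : Type*} [CommRing R] [IsLocalRing R]
    [IsNoetherianRing R] {p : ℕ} (hp : p.Prime) [CharP (ResidueField R) p]
    {C : Type*} [CommRing C] [IsLocalRing C] [Algebra R C] (σ : C →ₐ[R] C) (ev : C →ₐ[R] R)
    [IsLocalHom ev.toRingHom] {s : ℕ} (hs : 0 < s)
    (hinj : ∀ c, (∀ i, ev ((σ ^ i) c) = 0) → c = 0)
    (hper : ∀ i, (∀ c, ev ((σ ^ i) c) = ev c) ↔ s ∣ i)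
    {A : Type*} [CommRing A] [IsLocalRing A] [Algebra (ResidueField R) A] (q : C →+* A)
    (hq : Function.Surjective q)
    (hker : RingHom.ker q ≤ (maximalIdeal R).map (algebraMap R C))
    (hqR : ∀ r, q (algebraMap R C r) = algebraMap (ResidueField R) A (residue R r))
    (τ : A →ₐ[ResidueField R] A) (hτ : ∀ c, q (σ c) = τ (q c))
    (hτm : maximalIdeal A ≤ (maximalIdeal A).comap τ) :
    0 < orderOf ((maximalIdeal A).mapCotangent (maximalIdeal A) τ hτm :
        Module.End (ResidueField R) (maximalIdeal A).Cotangent) ∧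
      (∃ e, s = orderOf ((maximalIdeal A).mapCotangent (maximalIdeal A) τ hτm :
        Module.End (ResidueField R) (maximalIdeal A).Cotangent) * p ^ e) ∧
      (Subsingleton (maximalIdeal A).Cotangent → s = 1) := by
  have hσs : σ ^ s = 1 := by
    ext c
    rw [AlgHom.one_apply, ← sub_eq_zero]
    refine hinj _ fun i => ?_
    rw [map_sub, map_sub, sub_eq_zero, ← AlgHom.mul_apply, ← pow_add, add_comm, pow_add,
      AlgHom.mul_apply]
    exact (hper s).mpr dvd_rfl _
  -- The points `ev ∘ σ ^ i` with `i < s` embed `C` into `R ^ s`.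
  have : Module.Finite R C := by
    let F : C →ₗ[R] (Fin s → R) := LinearMap.pi fun i => ev.toLinearMap ∘ₗ (σ ^ (i : ℕ)).toLinearMap
    refine Module.Finite.of_injective F ((injective_iff_map_eq_zero F).mpr fun c hc => hinj c ?_)
    intro i
    have h1 := congrFun hc ⟨i % s, Nat.mod_lt i hs⟩
    have h2 : σ ^ (i % s) = σ ^ i := by
      conv_rhs => rw [← Nat.mod_add_div i s, pow_add, pow_mul, hσs, one_pow, mul_one]
    change ev ((σ ^ (i % s)) c) = 0 at h1
    rwa [h2] at h1
  have : IsNoetherianRing C := IsNoetherianRing.of_finite R C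
  have : IsNoetherianRing A := isNoetherianRing_of_surjective C A q hq
  have hloc : IsLocalHom q := IsLocalHom.of_surjective q hq
  have hevm : ∀ c, c - algebraMap R C (ev c) ∈ maximalIdeal C := fun c hu => by
    have := hu.map ev.toRingHom
    simp at this
  have hA : ∀ a : A, ∃ c : ResidueField R,
      a - algebraMap (ResidueField R) A c ∈ maximalIdeal A := fun a => by
    obtain ⟨c, rfl⟩ := hq a
    refine ⟨residue R (ev c), ?_⟩
    rw [← hqR, ← map_sub]
    exact fun hu => hevm c (hloc.map_nonunit _ hu)
  have hτi : ∀ i c, q ((σ ^ i) c) = (τ ^ i) (q c) := fun i c => by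
    induction i with
    | zero => rfl
    | succ i ih => rw [pow_succ', pow_succ', AlgHom.mul_apply, hτ, ih, AlgHom.mul_apply]
  have hτs : τ ^ s = 1 := by
    ext a
    obtain ⟨c, rfl⟩ := hq a
    rw [← hτi, hσs]; rfl
  have hmap : ∀ c : C, q c = 0 → c ∈ maximalIdeal R • (⊤ : Submodule R C) := fun c hc => by
    rw [Ideal.smul_top_eq_map]
    exact hker hc
  set T : Module.End (ResidueField R) (maximalIdeal A).Cotangent :=
    (maximalIdeal A).mapCotangent (maximalIdeal A) τ hτm with hT
  have hTs : T ^ s = 1 := by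
    ext x
    obtain ⟨x, rfl⟩ := (maximalIdeal A).toCotangent_surjective x
    obtain ⟨hx, e⟩ := mapCotangent_pow_toCotangent _ τ hτm s x
    rw [hT, e, Module.End.one_apply]
    congr 2
    rw [hτs]; rfl
  have hpos : 0 < orderOf T := orderOf_pos_iff.mpr (isOfFinOrder_iff_pow_eq_one.mpr ⟨s, hs, hTs⟩)
  refine ⟨hpos, ?_, fun hsub => ?_⟩
  · -- With `s = orderOf T * p ^ a * t` and `p ∤ t`, the power `σ ^ N` with `N = orderOf T * p ^ a`
    -- has order prime to `p` and is trivial on the cotangent space, so it is trivial on `A`, then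
    -- on `C`.
    obtain ⟨s', hs'⟩ := orderOf_dvd_of_pow_eq_one hTs
    have hs'0 : s' ≠ 0 := by rintro rfl; omega
    obtain ⟨a, t, hpt, hat⟩ := Nat.exists_eq_pow_mul_and_not_dvd hs'0 p hp.ne_one
    set N := orderOf T * p ^ a with hN
    have hst : s = N * t := by rw [hs', hat, hN, mul_assoc]
    have htκ : (t : ResidueField R) ≠ 0 := by
      rwa [Ne, CharP.cast_eq_zero_iff (ResidueField R) p]
    have htR : IsUnit (t : R) := by
      refine IsUnit.of_map (residue R) _ ?_
      rw [map_natCast]; exact htκ.isUnit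
    have hρA : ∀ x, (τ ^ N) x = x := by
      refine apply_eq_self_of_sub_mem_sq hA (t := t) ?_ htκ.isUnit (fun x hx => ?_) fun x hx => ?_
      · rw [← pow_mul, ← hst, hτs]
      · exact (mapCotangent_pow_toCotangent _ τ hτm N ⟨x, hx⟩).1
      · obtain ⟨hx', e⟩ := mapCotangent_pow_toCotangent _ τ hτm N ⟨x, hx⟩
        have hTN : T ^ N = 1 := by rw [hN, pow_mul, pow_orderOf_eq_one, one_pow]
        rw [← hT, hTN, Module.End.one_apply] at e
        exact (Ideal.toCotangent_eq _).mp e.symm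
    have hρ : (σ ^ N).toLinearMap = 1 := by
      refine eq_one_of_sub_mem_maximalIdeal_smul (t := t) ?_ htR fun c => hmap _ ?_
      · ext c
        rw [Module.End.pow_apply, Module.End.one_apply]
        change (⇑(σ ^ N))^[t] c = c
        rw [← AlgHom.coe_pow, ← pow_mul, ← hst, hσs, AlgHom.one_apply]
      · change q ((σ ^ N) c - c) = 0
        rw [map_sub, hτi, hρA, sub_self]
    have hdvd : s ∣ N := (hper N).mp fun c => congrArg ev (LinearMap.congr_fun hρ c)
    refine ⟨a, ?_⟩
    exact Nat.dvd_antisymm hdvd ⟨t, hst⟩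
  · have hfield : IsField A := by
      rw [← IsLocalRing.subsingleton_cotangentSpace_iff]
      exact hsub
    have hbot : maximalIdeal A = ⊥ := (IsLocalRing.isField_iff_maximalIdeal_eq).mp hfield
    -- By Nakayama's lemma `C` is generated by `1` as an `R`-module.
    have hle : (⊤ : Submodule R C) ≤ Submodule.span R {1} := by
      refine Submodule.le_of_le_smul_of_le_jacobson_bot (I := maximalIdeal R)
        (Module.Finite.fg_top) (IsLocalRing.maximalIdeal_le_jacobson _) fun c _ => ?_
      have h1 : q (c - algebraMap R C (ev c)) = 0 := by
        have : q (c - algebraMap R C (ev c)) ∈ maximalIdeal A :=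
          fun hu => hevm c (hloc.map_nonunit _ hu)
        rwa [hbot] at this
      rw [← add_sub_cancel (algebraMap R C (ev c)) c]
      refine Submodule.add_mem_sup ?_ (hmap _ h1)
      rw [Algebra.algebraMap_eq_smul_one]
      exact Submodule.smul_mem _ _ (Submodule.mem_span_singleton_self _)
    refine Nat.dvd_one.mp ((hper 1).mp fun c => ?_)
    obtain ⟨r, rfl⟩ := Submodule.mem_span_singleton.mp (hle (Submodule.mem_top (x := c)))
    simp

end LocalPeriod

/-! ### Dimension of standard smooth algebras -/

section Dimension

open scoped TensorProduct

/-- A rational point of affine `n`-space is a prime ideal of height `n`. -/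
theorem height_ker_algHom_mvPolynomial_fin {K : Type*} [Field K] (n : ℕ)
    (f : MvPolynomial (Fin n) K →ₐ[K] K) : (RingHom.ker f).height = n := by
  induction n with
  | zero =>
    have : Function.Injective f := by
      intro x y hxy
      obtain ⟨a, rfl⟩ := MvPolynomial.C_surjective (Fin 0) x
      obtain ⟨b, rfl⟩ := MvPolynomial.C_surjective (Fin 0) y
      rw [← MvPolynomial.algebraMap_eq, f.commutes, f.commutes] at hxy
      exact congrArg _ hxy
    rw [(RingHom.injective_iff_ker_eq_bot f).mp this]
    simp
  | succ n ih =>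
    let e := MvPolynomial.finSuccEquiv K n
    let g : Polynomial (MvPolynomial (Fin n) K) →ₐ[K] K := f.comp e.symm.toAlgHom
    let h : MvPolynomial (Fin n) K →ₐ[K] K :=
      g.comp (Algebra.ofId _ _ |>.restrictScalars K)
    have hg : Function.Surjective g := fun c => ⟨algebraMap K _ c, g.commutes c⟩
    have hmax : (RingHom.ker g).IsMaximal := RingHom.ker_isMaximal_of_surjective g hg
    have hover : (RingHom.ker g).LiesOver (RingHom.ker h) := ⟨by ext x; rfl⟩
    have h1 := Polynomial.height_eq_height_add_one (RingHom.ker h) (RingHom.ker g)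
    have h2 : RingHom.ker f = (RingHom.ker g).comap (e : _ ≃+* _) := by
      ext x
      simp [g, RingHom.mem_ker]
    rw [h2, RingEquiv.height_comap, h1, ih]
    simp

theorem height_ker_algHom_mvPolynomial {K ι : Type*} [Field K] [Finite ι]
    (f : MvPolynomial ι K →ₐ[K] K) : (RingHom.ker f).height = Nat.card ι := by
  let e := MvPolynomial.renameEquiv K (Finite.equivFin ι)
  have h2 : RingHom.ker f = (RingHom.ker (f.comp e.symm.toAlgHom)).comap (e : _ ≃+* _) := by
    ext x
    simp [RingHom.mem_ker]
  rw [h2, RingEquiv.height_comap, height_ker_algHom_mvPolynomial_fin]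

/-- A standard smooth algebra of relative dimension `n` over a field has dimension at least `n`
if it has a rational point: at this point it is cut out by `c` equations in an affine space of
dimension `n + c`, so Krull's height theorem applies. -/
theorem le_ringKrullDim_of_isStandardSmooth {K S : Type*} [Field K] [CommRing S] [Algebra K S]
    (n : ℕ) [Algebra.IsStandardSmoothOfRelativeDimension n K S] (f : S →ₐ[K] K) :
    (n : WithBot ℕ∞) ≤ ringKrullDim S := by
  obtain ⟨ι, σ, _, _, P, rfl⟩ := Algebra.IsStandardSmoothOfRelativeDimension.out (n := n)
    (R := K) (S := S)
  let g : MvPolynomial ι K →ₐ[K] S := MvPolynomial.aeval P.val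
  have hg : Function.Surjective g := P.aeval_val_surjective
  have hker : RingHom.ker g = Ideal.span (Set.range P.relation) := by
    rw [P.span_range_relation_eq_ker, Algebra.Generators.ker_eq_ker_aeval_val]
  have hle : Set.range P.relation ⊆ RingHom.ker (f.comp g) := by
    rintro _ ⟨j, rfl⟩
    have : P.relation j ∈ RingHom.ker g := by
      rw [hker]; exact Ideal.subset_span ⟨j, rfl⟩
    simp only [SetLike.mem_coe, RingHom.mem_ker, AlgHom.comp_apply] at this ⊢
    rw [this, map_zero]
  have hp : (RingHom.ker (f.comp g)).IsPrime := RingHom.ker_isPrime _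
  have h1 := Ideal.height_le_ringKrullDim_quotient_add_encard _ hle
  have hdim : ringKrullDim (MvPolynomial ι K ⧸ RingHom.ker g) = ringKrullDim S :=
    ringKrullDim_eq_of_ringEquiv (RingHom.quotientKerEquivOfSurjective (f := g.toRingHom) hg)
  rw [height_ker_algHom_mvPolynomial, ← hker] at h1
  have h2 : (Set.range P.relation).encard ≤ Nat.card σ := by
    rw [← Set.image_univ]
    refine (Set.encard_image_le _ _).trans ?_
    rw [Set.encard_univ, ENat.card_eq_coe_natCard]
  have h3 : ((Nat.card ι : ℕ∞) : WithBot ℕ∞) ≤ ringKrullDim S + ((Nat.card σ : ℕ∞) : WithBot ℕ∞) :=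
    h1.trans (add_le_add hdim.le (by exact_mod_cast h2))
  rw [Algebra.Presentation.dimension]
  generalize ringKrullDim S = D at h3
  induction D with
  | bot => simp at h3
  | coe D =>
    induction D with
    | top => exact le_top
    | coe D =>
      norm_cast at h3
      have h4 : Nat.card ι - Nat.card σ ≤ D := by
        rw [Nat.sub_le_iff_le_add]; exact_mod_cast h3
      exact WithBot.coe_le_coe.mpr (ENat.natCast_le_natCast.mpr h4)

/-- The cotangent space at a rational point of the special fibre of a standard smooth algebra of
relative dimension `n` has dimension at most `n`: it is spanned by the image of `Ω[S⁄R]`, which is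
free of rank `n`. The local ring `A` of the special fibre enters through a map `j : S → A` all
elements of `A` being fractions of elements of its image. -/
theorem finrank_cotangent_le_of_isStandardSmooth {R S : Type*} [CommRing R] [IsLocalRing R]
    [CommRing S] [Nontrivial S] [Algebra R S]
    (n : ℕ) [Algebra.IsStandardSmoothOfRelativeDimension n R S]
    {A : Type*} [CommRing A] [IsLocalRing A] [Algebra (ResidueField R) A]
    (j : S →+* A) (hjR : ∀ r, j (algebraMap R S r) = algebraMap (ResidueField R) A (residue R r))
    (hj : ∀ a : A, ∃ x y : S, IsUnit (j y) ∧ a * j y = j x)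
    (e : S →+* ResidueField R) (he : ∀ r, e (algebraMap R S r) = residue R r)
    (hje : ∀ x, j x - algebraMap (ResidueField R) A (e x) ∈ maximalIdeal A) :
    FiniteDimensional (ResidueField R) (maximalIdeal A).Cotangent ∧
      Module.finrank (ResidueField R) (maximalIdeal A).Cotangent ≤ n := by
  set κ := ResidueField R
  let _ : Module S (maximalIdeal A).Cotangent := Module.compHom _ e
  let _ : Module R (maximalIdeal A).Cotangent := Module.compHom _ (residue R)
  have hS : ∀ (x : S) (v : (maximalIdeal A).Cotangent), x • v = e x • v := fun _ _ => rfl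
  have hR : ∀ (x : R) (v : (maximalIdeal A).Cotangent), x • v = residue R x • v := fun _ _ => rfl
  have : IsScalarTower R S (maximalIdeal A).Cotangent := ⟨fun r x v => by
    rw [Algebra.smul_def, hS, hS, hR, map_mul, he, mul_smul]⟩
  -- In `𝔪_A / 𝔪_A ^ 2` an element of `A` acts through its value in the residue field.
  have hact : ∀ (x : S) (v : maximalIdeal A), (maximalIdeal A).toCotangent
      ⟨j x * v, (maximalIdeal A).mul_mem_left _ v.2⟩ = e x • (maximalIdeal A).toCotangent v := by
    intro x v
    rw [← algebraMap_smul A (e x), ← map_smul, Ideal.toCotangent_eq]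
    simp only [SetLike.val_smul, smul_eq_mul]
    rw [← sub_mul, sq]
    exact Ideal.mul_mem_mul (hje x) v.2
  let d₀ : S → maximalIdeal A := fun x => ⟨j x - algebraMap κ A (e x), hje x⟩
  let D : Derivation R S (maximalIdeal A).Cotangent :=
    { toFun := fun x => (maximalIdeal A).toCotangent (d₀ x)
      map_add' := fun x y => by
        rw [← map_add]; congr 1; ext; simp [d₀]; ring
      map_smul' := fun r x => by
        rw [RingHom.id_apply, hR, ← he, ← hact]
        congr 1; ext
        simp only [d₀, Algebra.smul_def, map_mul, he, hjR]
        ring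
      map_one_eq_zero' := by
        change (maximalIdeal A).toCotangent (d₀ 1) = 0
        rw [Ideal.toCotangent_eq_zero]; simp [d₀]
      leibniz' := fun x y => by
        change (maximalIdeal A).toCotangent (d₀ (x * y)) = x • (maximalIdeal A).toCotangent (d₀ y) +
          y • (maximalIdeal A).toCotangent (d₀ x)
        rw [hS, hS, ← hact, ← algebraMap_smul A (e y), ← map_smul, ← map_add]
        congr 1; ext
        simp [d₀, Algebra.smul_def]; ring }
  let l := D.liftKaehlerDifferential
  have : Algebra.IsStandardSmooth R S :=
    Algebra.IsStandardSmoothOfRelativeDimension.isStandardSmooth n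
  let b := Module.Free.chooseBasis S (Ω[S⁄R])
  have hcard : Nat.card (Module.Free.ChooseBasisIndex S (Ω[S⁄R])) = n := by
    have h1 := Algebra.IsStandardSmoothOfRelativeDimension.rank_kaehlerDifferential
      (R := R) (S := S) n
    rw [Module.Free.rank_eq_card_chooseBasisIndex] at h1
    rw [Nat.card, h1, Cardinal.toNat_natCast]
  have hspan : Submodule.span κ (Set.range fun i => l (b i)) = ⊤ := by
    rw [eq_top_iff]
    have hD : ∀ x, D x ∈ Submodule.span κ (Set.range fun i => l (b i)) := fun x => by
      rw [← D.liftKaehlerDifferential_comp_D x, ← b.sum_repr (KaehlerDifferential.D R S x), map_sum]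
      refine Submodule.sum_mem _ fun i _ => ?_
      rw [map_smul, hS]
      exact Submodule.smul_mem _ _ (Submodule.subset_span ⟨i, rfl⟩)
    intro v _
    obtain ⟨⟨a, ha⟩, rfl⟩ := (maximalIdeal A).toCotangent_surjective v
    obtain ⟨x, y, hy, hxy⟩ := hj a
    have hjx : j x ∈ maximalIdeal A := by
      rw [← hxy]; exact Ideal.mul_mem_right _ _ ha
    have hey : e y ≠ 0 := by
      intro h0
      have := hje y
      rw [h0, map_zero, sub_zero] at this
      exact this hy
    have hex : e x = 0 := by
      by_contra h0
      have := Ideal.sub_mem _ hjx (hje x)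
      rw [sub_sub_cancel] at this
      exact this ((Ne.isUnit h0).map (algebraMap κ A))
    have h1 : e y • (maximalIdeal A).toCotangent ⟨a, ha⟩ = D x := by
      rw [← hact]
      change _ = (maximalIdeal A).toCotangent (d₀ x)
      congr 1; ext
      simp only [d₀, hex, map_zero, sub_zero]
      rw [mul_comm, hxy]
    rw [← inv_smul_smul₀ hey ((maximalIdeal A).toCotangent ⟨a, ha⟩), h1]
    exact Submodule.smul_mem _ _ (hD x)
  refine ⟨Module.Finite.of_fg_top ?_, ?_⟩
  · exact ⟨(Set.finite_range fun i => l (b i)).toFinset, by simpa using hspan⟩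
  · have := finrank_range_le_card (R := κ) fun i => l (b i)
    rw [Set.finrank, hspan, finrank_top, ← Nat.card_eq_fintype_card, hcard] at this
    exact this

end Dimension

/-! ### Iterates and primitive periods -/

section Dynamics

variable {C : Type*} [Category C]

theorem iter_add {X : C} (φ : X ⟶ X) (i j : ℕ) : iter φ (i + j) = iter φ i ≫ iter φ j := by
  induction j with
  | zero => simp [iter_zero]
  | succ j ih => rw [← add_assoc, iter_succ, ih, iter_succ, Category.assoc]

theorem iter_mul {X : C} (φ : X ⟶ X) (i j : ℕ) : iter φ (i * j) = iter (iter φ i) j := by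
  induction j with
  | zero => rfl
  | succ j ih => rw [Nat.mul_succ, iter_add, ih, iter_succ]

theorem map_iter {D : Type*} [Category D] (F : C ⥤ D) {X : C} (φ : X ⟶ X) (i : ℕ) :
    F.map (iter φ i) = iter (F.map φ) i := by
  induction i with
  | zero => simp [iter_zero]
  | succ i ih => rw [iter_succ, iter_succ, F.map_comp, ih]

theorem comp_iter_eq_self {T X : C} {φ : X ⟶ X} {P : T ⟶ X} (h : P ≫ φ = P) (i : ℕ) :
    P ≫ iter φ i = P := by
  induction i with
  | zero => simp [iter_zero]
  | succ i ih => rw [iter_succ, ← Category.assoc, ih, h]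

theorem IsPrimitivePeriod.comp_iter_eq_iff {T X : C} {φ : X ⟶ X} {P : T ⟶ X} {n : ℕ}
    (h : IsPrimitivePeriod φ P n) (i : ℕ) : P ≫ iter φ i = P ↔ n ∣ i := by
  have key : P ≫ iter φ i = P ≫ iter φ (i % n) := by
    conv_lhs => rw [← Nat.div_add_mod i n, iter_add, iter_mul, ← Category.assoc,
      comp_iter_eq_self h.1.2]
  constructor
  · intro hi
    rw [key] at hi
    by_contra hd
    have hlt := Nat.mod_lt i h.1.1
    have := h.2 ⟨Nat.pos_of_ne_zero fun h0 => hd (Nat.dvd_of_mod_eq_zero h0), hi⟩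
    omega
  · rintro ⟨j, rfl⟩
    rw [iter_mul, comp_iter_eq_self h.1.2]

end Dynamics

/-! ### Local homomorphisms between stalks -/

section Stalks

/-- The homomorphism of local rings at `y = g(x)` and `x` which a morphism `g` induces. -/
noncomputable def stalkHom {X Y : Scheme.{u}} (g : X ⟶ Y) {x : X} {y : Y} (h : g x = y) :
    Y.presheaf.stalk y ⟶ X.presheaf.stalk x :=
  Y.presheaf.stalkSpecializes (specializes_of_eq h) ≫ g.stalkMap x

theorem localHom_eq_stalkHom {k : Type u} [Field k] {Z Z' : Over (Spec (.of k))} {z : pt k ⟶ Z}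
    {z' : pt k ⟶ Z'} (g : Z ⟶ Z') (h : z ≫ g = z') :
    localHom g h = stalkHom g.left (pointOf_comp g h) := rfl

theorem specMap_stalkHom_fromSpecStalk {X Y : Scheme.{u}} (g : X ⟶ Y) {x : X} {y : Y}
    (h : g x = y) :
    Spec.map (stalkHom g h) ≫ Y.fromSpecStalk y = X.fromSpecStalk x ≫ g := by
  rw [stalkHom, Spec.map_comp, Category.assoc, Scheme.SpecMap_stalkSpecializes_fromSpecStalk,
    Scheme.SpecMap_stalkMap_fromSpecStalk]

instance isLocalHom_stalkHom {X Y : Scheme.{u}} (g : X ⟶ Y) {x : X} {y : Y} (h : g x = y) :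
    IsLocalHom (stalkHom g h).hom := by
  subst h
  have : IsIso (Y.presheaf.stalkSpecializes (specializes_of_eq (rfl : g x = g x))) :=
    (Y.presheaf.stalkCongr (.of_eq rfl)).isIso_hom
  rw [stalkHom, CommRingCat.hom_comp]
  infer_instance

theorem stalkHom_surjective {X Y : Scheme.{u}} (g : X ⟶ Y) [SurjectiveOnStalks g] {x : X} {y : Y}
    (h : g x = y) : Function.Surjective (stalkHom g h).hom := by
  subst h
  have : IsIso (Y.presheaf.stalkSpecializes (specializes_of_eq (rfl : g x = g x))) :=
    (Y.presheaf.stalkCongr (.of_eq rfl)).isIso_hom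
  rw [stalkHom, CommRingCat.hom_comp]
  exact (g.stalkMap_surjective x).comp
    (ConcreteCategory.bijective_of_isIso (Y.presheaf.stalkSpecializes _)).surjective

theorem germ_stalkHom {X Y : Scheme.{u}} (g : X ⟶ Y) {x : X} {y : Y} (h : g x = y)
    (U : Y.Opens) (hU : y ∈ U) :
    Y.presheaf.germ U y hU ≫ stalkHom g h =
      g.app U ≫ X.presheaf.germ (g ⁻¹ᵁ U) x (by subst h; exact hU) := by
  rw [stalkHom, TopCat.Presheaf.germ_stalkSpecializes_assoc]
  exact Scheme.Hom.germ_stalkMap _ _ _ _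

/-- A homomorphism out of a local ring of a scheme is determined by the associated morphism of
schemes, as `Spec` of the local ring is a monomorphism into the scheme. -/
theorem stalk_hom_ext {X : Scheme.{u}} {x : X} {A : CommRingCat.{u}}
    {f g : X.presheaf.stalk x ⟶ A}
    (h : Spec.map f ≫ X.fromSpecStalk x = Spec.map g ≫ X.fromSpecStalk x) : f = g :=
  Spec.map_injective ((cancel_mono _).mp h)

variable {A : CommRingCat.{u}} [IsLocalRing A]

/-- The evaluation `𝒪_{X,x} → A` at a morphism `f : Spec A ⟶ X` that maps the closed point to
`x`. -/
noncomputable def evalAt {X : Scheme.{u}} (f : Spec A ⟶ X) {x : X} (h : f (closedPoint A) = x) :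
    X.presheaf.stalk x ⟶ A :=
  X.presheaf.stalkSpecializes (specializes_of_eq h) ≫ Scheme.stalkClosedPointTo f

theorem specMap_evalAt_fromSpecStalk {X : Scheme.{u}} (f : Spec A ⟶ X) {x : X}
    (h : f (closedPoint A) = x) : Spec.map (evalAt f h) ≫ X.fromSpecStalk x = f := by
  rw [evalAt, Spec.map_comp, Category.assoc, Scheme.SpecMap_stalkSpecializes_fromSpecStalk,
    Scheme.Spec_stalkClosedPointTo_fromSpecStalk]

instance isLocalHom_evalAt {X : Scheme.{u}} (f : Spec A ⟶ X) {x : X}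
    (h : f (closedPoint A) = x) :
    IsLocalHom (evalAt f h).hom := by
  subst h
  have : IsIso (X.presheaf.stalkSpecializes
      (specializes_of_eq (rfl : f (closedPoint A) = f (closedPoint A)))) :=
    (X.presheaf.stalkCongr (.of_eq rfl)).isIso_hom
  rw [evalAt, CommRingCat.hom_comp]
  infer_instance

theorem stalkHom_comp_evalAt {X Y : Scheme.{u}} {f : Spec A ⟶ X} {g : X ⟶ Y} {f' : Spec A ⟶ Y}
    (e : f ≫ g = f') {x : X} {y : Y} (hg : g x = y) (hf : f (closedPoint A) = x)
    (hf' : f' (closedPoint A) = y) : stalkHom g hg ≫ evalAt f hf = evalAt f' hf' := by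
  apply stalk_hom_ext
  rw [Spec.map_comp, Category.assoc, specMap_stalkHom_fromSpecStalk, ← Category.assoc,
    specMap_evalAt_fromSpecStalk, specMap_evalAt_fromSpecStalk, e]

theorem germ_evalAt_eq_zero_iff {X : Scheme.{u}} (f : Spec A ⟶ X) {x : X}
    (h : f (closedPoint A) = x) (U : X.Opens) (hU : x ∈ U) (a : Γ(X, U)) :
    (evalAt f h).hom (X.presheaf.germ U x hU a) = 0 ↔ f.app U a = 0 := by
  subst h
  have e : X.presheaf.germ U _ hU ≫ evalAt f rfl = f.app U ≫
      ((Spec A).presheaf.mapIso (eqToIso (Scheme.preimage_eq_top_of_closedPoint_mem f hU).symm).op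
        ≪≫ Scheme.ΓSpecIso A).hom := by
    rw [evalAt, TopCat.Presheaf.germ_stalkSpecializes_assoc, Scheme.germ_stalkClosedPointTo]
  have e' : (evalAt f rfl).hom (X.presheaf.germ U _ hU a) = _ := congrArg (fun q => q.hom a) e
  rw [e']
  exact map_eq_zero_iff _ (ConcreteCategory.bijective_of_isIso
    ((Spec A).presheaf.mapIso (eqToIso (Scheme.preimage_eq_top_of_closedPoint_mem f hU).symm).op
        ≪≫ Scheme.ΓSpecIso A).hom).injective

end Stalks

/-! ### Local rings of schemes over an affine base -/

section Structure

variable {R : Type u} [CommRing R]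

/-- The structure of an `R`-algebra on a local ring of an `R`-scheme. -/
noncomputable def stalkStructure (Z : Over (Spec (.of R))) (x : Z.left) :
    CommRingCat.of R ⟶ Z.left.presheaf.stalk x :=
  (Scheme.ΓSpecIso (.of R)).inv ≫ Z.hom.appTop ≫ Z.left.presheaf.germ ⊤ x
    (TopologicalSpace.Opens.mem_top _)

theorem specMap_stalkStructure (Z : Over (Spec (.of R))) (x : Z.left) :
    Spec.map (stalkStructure Z x) = Z.left.fromSpecStalk x ≫ Z.hom := by
  rw [stalkStructure, Spec.map_comp, Spec.map_comp, ← Scheme.fromSpecStalk_toSpecΓ,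
    Category.assoc, Category.assoc, ← Scheme.toSpecΓ_naturality_assoc]
  congr 1
  rw [← SpecMap_ΓSpecIso_hom, ← Spec.map_comp, Iso.inv_hom_id]
  simp

theorem structureHom_eq_stalkStructure {k : Type u} [Field k] {Z : Over (Spec (.of k))}
    (z : pt k ⟶ Z) : structureHom z = stalkStructure Z (pointOf z) := rfl

end Structure

/-! ### Local rings of the special fibre -/

section SpecialFibre

variable {R : Type u} [CommRing R]

theorem stalkStructure_comp_stalkHom {Z Z' : Over (Spec (.of R))} (g : Z ⟶ Z') {x : Z.left}
    {y : Z'.left} (h : g.left x = y) :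
    stalkStructure Z' y ≫ stalkHom g.left h = stalkStructure Z x := by
  apply Spec.map_injective
  rw [Spec.map_comp, specMap_stalkStructure, ← Category.assoc, specMap_stalkHom_fromSpecStalk,
    Category.assoc, Over.w, specMap_stalkStructure]

variable [IsLocalRing R]

theorem stalkStructure_comp_evalAt {Z : Over (Spec (.of R))} (P : pt R ⟶ Z) {x : Z.left}
    (h : P.left (closedPoint R) = x) :
    stalkStructure Z x ≫ evalAt (A := .of R) P.left h = 𝟙 (CommRingCat.of R) := by
  apply Spec.map_injective
  rw [Spec.map_comp, specMap_stalkStructure, ← Category.assoc, specMap_evalAt_fromSpecStalk,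
    Spec.map_id]
  exact Over.w P

/-- The inclusion of the special fibre. -/
noncomputable abbrev specialFibreι (Z : Over (Spec (.of R))) :
    ((specialFibre R).obj Z).left ⟶ Z.left :=
  pullback.fst Z.hom (residueSpec R)

instance : IsClosedImmersion (residueSpec R) :=
  IsClosedImmersion.spec_of_surjective _ residue_surjective

theorem specialFibre_map_left_comp {Z Z' : Over (Spec (.of R))} (g : Z ⟶ Z') :
    ((specialFibre R).map g).left ≫ specialFibreι Z' = specialFibreι Z ≫ g.left :=
  pullback.lift_fst _ _ _

theorem reduction_left_comp {Z : Over (Spec (.of R))} (P : pt R ⟶ Z) :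
    (reduction P).left ≫ specialFibreι Z = residueSpec R ≫ P.left :=
  pullback.lift_fst _ _ _

theorem residueSpec_closedPoint :
    residueSpec R (closedPoint (ResidueField R)) = closedPoint R :=
  IsLocalRing.comap_closedPoint (residue R)

theorem specialFibreι_pointOf_reduction {Z : Over (Spec (.of R))} (P : pt R ⟶ Z) :
    specialFibreι Z (pointOf (reduction P)) = P.left (closedPoint R) := by
  have e : specialFibreι Z (pointOf (reduction P)) =
      P.left (residueSpec R (closedPoint (ResidueField R))) :=
    congrArg (fun f => f (closedPoint (ResidueField R))) (reduction_left_comp P)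
  rw [e]
  exact congrArg P.left residueSpec_closedPoint

/-- A point of the special fibre over the residue field lies over the closed point. -/
theorem hom_specialFibreι_pointOf {Z : Over (Spec (.of R))}
    (z : pt (ResidueField R) ⟶ (specialFibre R).obj Z) :
    Z.hom (specialFibreι Z (pointOf z)) = closedPoint R := by
  have h : z.left ≫ specialFibreι Z ≫ Z.hom = residueSpec R := by
    rw [pullback.condition]
    have := Over.w z
    change z.left ≫ pullback.snd _ _ = 𝟙 _ at this
    rw [← Category.assoc, this, Category.id_comp]
  have e : Z.hom (specialFibreι Z (pointOf z)) = residueSpec R (closedPoint (ResidueField R)) :=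
    congrArg (fun f => f (closedPoint (ResidueField R))) h
  exact e.trans residueSpec_closedPoint

theorem stalkStructure_comp_stalkHom_specialFibreι {Z : Over (Spec (.of R))}
    (z : pt (ResidueField R) ⟶ (specialFibre R).obj Z) {y : Z.left}
    (h : specialFibreι Z (pointOf z) = y) :
    stalkStructure Z y ≫ stalkHom (specialFibreι Z) h =
      CommRingCat.ofHom (residue R) ≫ structureHom z := by
  apply Spec.map_injective
  rw [Spec.map_comp, specMap_stalkStructure, ← Category.assoc, specMap_stalkHom_fromSpecStalk,
    Category.assoc, pullback.condition, Spec.map_comp, structureHom_eq_stalkStructure,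
    specMap_stalkStructure, Category.assoc]
  rfl

/-- The local ring of the special fibre is the local ring of `Z` modulo the maximal ideal of the
base: by the universal property of the fibre product, this quotient receives a map from the
local ring of the special fibre. -/
theorem ker_stalkHom_specialFibreι_le {Z : Over (Spec (.of R))}
    (z : pt (ResidueField R) ⟶ (specialFibre R).obj Z) {y : Z.left}
    (h : specialFibreι Z (pointOf z) = y) :
    RingHom.ker (stalkHom (specialFibreι Z) h).hom ≤
      (maximalIdeal R).map (stalkStructure Z y).hom := by
  set q := stalkHom (specialFibreι Z) h with hq
  set J := (maximalIdeal R).map (stalkStructure Z y).hom with hJ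
  have hJq : J ≤ RingHom.ker q.hom := by
    rw [hJ, Ideal.map_le_iff_le_comap]
    intro r hr
    have e := congrArg (fun f => f.hom r) (stalkStructure_comp_stalkHom_specialFibreι z h)
    change q.hom ((stalkStructure Z y).hom r) = (structureHom z).hom (residue R r) at e
    rw [Ideal.mem_comap, RingHom.mem_ker, e, (residue_eq_zero_iff r).mpr hr, map_zero]
  have hJt : J ≠ ⊤ := fun ht => RingHom.ker_ne_top q.hom (top_le_iff.mp (ht ▸ hJq))
  have hnt : Nontrivial (Z.left.presheaf.stalk y ⧸ J) := Ideal.Quotient.nontrivial_iff.mpr hJt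
  let D : CommRingCat.{u} := .of (Z.left.presheaf.stalk y ⧸ J)
  let mk : Z.left.presheaf.stalk y ⟶ D := CommRingCat.ofHom (Ideal.Quotient.mk J)
  have hloc : IsLocalRing D := IsLocalRing.of_surjective' (Ideal.Quotient.mk J)
    Ideal.Quotient.mk_surjective
  have hmk : IsLocalHom mk.hom := IsLocalHom.of_surjective _ Ideal.Quotient.mk_surjective
  let κD : CommRingCat.of (ResidueField R) ⟶ D :=
    CommRingCat.ofHom (Ideal.Quotient.lift (maximalIdeal R) (mk.hom.comp (stalkStructure Z y).hom)
      fun r hr => Ideal.Quotient.eq_zero_iff_mem.mpr (Ideal.mem_map_of_mem _ hr))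
  have hκD : CommRingCat.ofHom (residue R) ≫ κD = stalkStructure Z y ≫ mk := by
    ext r; rfl
  let w : Spec D ⟶ ((specialFibre R).obj Z).left :=
    pullback.lift (Spec.map mk ≫ Z.left.fromSpecStalk y) (Spec.map κD) (by
      rw [Category.assoc, ← specMap_stalkStructure, ← Spec.map_comp, ← hκD, Spec.map_comp])
  have hw : w ≫ specialFibreι Z = Spec.map mk ≫ Z.left.fromSpecStalk y := pullback.lift_fst _ _ _
  have hwz : w (closedPoint D) = pointOf z := by
    apply (specialFibreι Z).isEmbedding.injective
    have e : specialFibreι Z (w (closedPoint D)) =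
        Z.left.fromSpecStalk y (Spec.map mk (closedPoint D)) :=
      congrArg (fun f => f (closedPoint D)) hw
    have e' : Spec.map mk (closedPoint D) = closedPoint _ := IsLocalRing.comap_closedPoint mk.hom
    rw [e, e', Scheme.fromSpecStalk_closedPoint, h]
  have hfac : q ≫ evalAt w hwz = mk := by
    apply stalk_hom_ext
    rw [Spec.map_comp, Category.assoc, hq, specMap_stalkHom_fromSpecStalk, ← Category.assoc,
      specMap_evalAt_fromSpecStalk w, hw]
  intro c hc
  have e := congrArg (fun f => f.hom c) hfac
  change (evalAt w hwz).hom (q.hom c) = Ideal.Quotient.mk J c at e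
  rw [RingHom.mem_ker] at hc
  rw [hc, map_zero] at e
  exact Ideal.Quotient.eq_zero_iff_mem.mp e.symm

/-- The reduction of an `R`-valued point is determined by the image of the closed point. -/
theorem reduction_eq_of_closedPoint_eq {Z : Over (Spec (.of R))} {P Q : pt R ⟶ Z}
    (h : P.left (closedPoint R) = Q.left (closedPoint R)) : reduction P = reduction Q := by
  obtain ⟨x, hx⟩ : ∃ x, P.left (closedPoint R) = x := ⟨_, rfl⟩
  rw [hx] at h
  have key : evalAt (A := .of R) P.left hx ≫ CommRingCat.ofHom (residue R) =
      evalAt (A := .of R) Q.left h.symm ≫ CommRingCat.ofHom (residue R) := by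
    ext c
    have hP : ∀ r, (evalAt (A := .of R) P.left hx).hom ((stalkStructure Z _).hom r) = r := fun r =>
      congrArg (fun f => f.hom r) (stalkStructure_comp_evalAt P hx)
    have hQ : ∀ r, (evalAt (A := .of R) Q.left h.symm).hom ((stalkStructure Z _).hom r) = r :=
      fun r => congrArg (fun f => f.hom r) (stalkStructure_comp_evalAt Q h.symm)
    set a := (evalAt (A := .of R) P.left hx).hom c with ha
    have h1 : ¬ IsUnit (c - (stalkStructure Z _).hom a) := fun hu => by
      have := hu.map (evalAt (A := .of R) P.left hx).hom
      rw [map_sub, hP, ← ha, sub_self] at this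
      exact not_isUnit_zero this
    have h2 : (evalAt (A := .of R) Q.left h.symm).hom (c - (stalkStructure Z _).hom a) ∈
        maximalIdeal R :=
      fun hu => h1 ((isLocalHom_evalAt (A := .of R) Q.left h.symm).map_nonunit _ hu)
    rw [map_sub, hQ] at h2
    exact ((Ideal.Quotient.mk_eq_mk_iff_sub_mem _ _).mpr h2).symm
  ext1
  refine pullback.hom_ext ?_ ?_
  · have h3 : residueSpec R ≫ P.left = residueSpec R ≫ Q.left := by
      rw [← specMap_evalAt_fromSpecStalk (A := .of R) P.left hx,
        ← specMap_evalAt_fromSpecStalk (A := .of R) Q.left h.symm,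
        ← Category.assoc, ← Category.assoc, ← Spec.map_comp, ← Spec.map_comp, key]
    exact (reduction_left_comp P).trans (h3.trans (reduction_left_comp Q).symm)
  · exact (Over.w (reduction P)).trans (Over.w (reduction Q)).symm

end SpecialFibre

/-! ### Local rings of the scheme-theoretic union of an orbit -/

section OrbitStalk

variable {R : Type u} [CommRing R]

/-- An `R`-valued point of a separated `R`-scheme is a closed immersion. -/
theorem isClosedImmersion_point {Z : Over (Spec (.of R))} [IsSeparated Z.hom] (Q : pt R ⟶ Z) :
    IsClosedImmersion Q.left := by
  have : IsClosedImmersion (Q.left ≫ Z.hom) := by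
    rw [Over.w Q]
    exact inferInstanceAs (IsClosedImmersion (𝟙 _))
  exact MorphismProperty.of_postcomp @IsClosedImmersion Q.left Z.hom ‹_› this

variable {Z : Over (Spec (.of R))} {φ : Z ⟶ Z} {P : pt R ⟶ Z} {n : ℕ}

theorem orbitUnionPoint_iter_comp (h : IsPrimitivePeriod φ P n) (j : ℕ) :
    (orbitUnionPoint h ≫ iter (orbitUnionMap h) j) ≫ orbitUnionι φ P n = P ≫ iter φ j := by
  rw [Category.assoc, ← iter_comp_of_comm (orbitUnionι_comp h), ← Category.assoc,
    orbitUnionPoint_comp]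

instance : IsClosedImmersion (orbitUnionι φ P n).left :=
  inferInstanceAs (IsClosedImmersion (orbitIdeal φ P n).subschemeι)

theorem mem_orbitIdeal_ideal_iff [IsSeparated Z.hom] (U : Z.left.affineOpens)
    (a : Γ(Z.left, U)) :
    a ∈ (orbitIdeal φ P n).ideal U ↔ ∀ j : Fin n, (P ≫ iter φ j).left.app U a = 0 := by
  have : ∀ j : Fin n, QuasiCompact (P ≫ iter φ j).left := fun j => by
    have := isClosedImmersion_point (P ≫ iter φ j)
    infer_instance
  rw [orbitIdeal, Scheme.IdealSheafData.ideal_iInf, iInf_apply, Submodule.mem_iInf]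
  refine forall_congr' fun j => ?_
  rw [Scheme.Hom.ker_apply]
  rfl

variable [IsLocalRing R]

/-- An element of a local ring of the scheme-theoretic union of an orbit, at a point of the
special fibre, vanishes if it does so at all points of the orbit which pass through the given
point. The other points of the orbit are closed, so they can be avoided by shrinking the
neighbourhood. -/
theorem eq_zero_of_forall_evalAt_eq_zero [IsSeparated Z.hom] (h : IsPrimitivePeriod φ P n)
    {y : (orbitUnion φ P n).left} (hy : (orbitUnion φ P n).hom y = closedPoint R)
    (c : (orbitUnion φ P n).left.presheaf.stalk y)
    (hc : ∀ j < n, ∀ hj : (orbitUnionPoint h ≫ iter (orbitUnionMap h) j).left (closedPoint R) = y,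
      (evalAt (A := .of R) (orbitUnionPoint h ≫ iter (orbitUnionMap h) j).left hj).hom c = 0) :
    c = 0 := by
  set ι := (orbitUnionι φ P n).left with hι
  obtain ⟨c', rfl⟩ := stalkHom_surjective ι (rfl : ι y = ι y) c
  obtain ⟨U₀, hU₀, f₀, rfl⟩ := Z.left.presheaf.exists_germ_eq c'
  have hcl : ∀ j : Fin n, IsClosed (Set.range (P ≫ iter φ j).left) := fun j =>
    (isClosedImmersion_point (P ≫ iter φ j)).isClosedEmbedding.isClosed_range
  have hZ : Z.hom (ι y) = closedPoint R := hy
  have hrange : ∀ j : Fin n, (P ≫ iter φ j).left (closedPoint R) ≠ ι y →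
      ι y ∈ (Set.range (P ≫ iter φ j).left)ᶜ := by
    rintro j hj ⟨t, ht⟩
    have e : Z.hom ((P ≫ iter φ j).left t) = t :=
      congrArg (fun f => f t) (Over.w (P ≫ iter φ j))
    rw [ht, hZ] at e
    exact hj (e ▸ ht)
  let O : Set Z.left := U₀ ∩ ⋂ j : Fin n, ⋂ _ : (P ≫ iter φ j).left (closedPoint R) ≠ ι y,
    (Set.range (P ≫ iter φ j).left)ᶜ
  have hO : IsOpen O := U₀.2.inter <| isOpen_iInter_of_finite fun j =>
    isOpen_iInter_of_finite fun _ => (hcl j).isOpen_compl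
  have hyO : ι y ∈ O := ⟨hU₀, Set.mem_iInter.mpr fun j => Set.mem_iInter.mpr (hrange j)⟩
  obtain ⟨_, ⟨U, hU, rfl⟩, hyU, hUO⟩ :=
    Z.left.isBasis_affineOpens.exists_subset_of_mem_open hyO hO
  have hUU₀ : U ≤ U₀ := fun x hx => (hUO hx).1
  let f : Γ(Z.left, U) := Z.left.presheaf.map (homOfLE hUU₀).op f₀
  have hf : Z.left.presheaf.germ U₀ (ι y) hU₀ f₀ = Z.left.presheaf.germ U (ι y) hyU f :=
    (Z.left.presheaf.germ_res_apply (homOfLE hUU₀) (ι y) hyU f₀).symm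
  change (stalkHom ι rfl).hom (Z.left.presheaf.germ U₀ (ι y) hU₀ f₀) = 0
  have hc' : ∀ j < n, ∀ hj :
      (orbitUnionPoint h ≫ iter (orbitUnionMap h) j).left (closedPoint R) = y,
      (evalAt (A := .of R) (orbitUnionPoint h ≫ iter (orbitUnionMap h) j).left hj).hom
        ((stalkHom ι rfl).hom (Z.left.presheaf.germ U₀ (ι y) hU₀ f₀)) = 0 := hc
  rw [hf] at hc' ⊢
  have hmem : f ∈ (orbitIdeal φ P n).ideal ⟨U, hU⟩ := by
    rw [mem_orbitIdeal_ideal_iff]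
    intro j
    have hQ : ∀ t, ι ((orbitUnionPoint h ≫ iter (orbitUnionMap h) j).left t) =
        (P ≫ iter φ j).left t := fun t =>
      congrArg (fun f => f.left t) (orbitUnionPoint_iter_comp h j)
    by_cases hj : (P ≫ iter φ j).left (closedPoint R) = ι y
    · have hj' : (orbitUnionPoint h ≫ iter (orbitUnionMap h) j).left (closedPoint R) = y :=
        ι.isEmbedding.injective ((hQ _).trans hj)
      have e : stalkHom ι rfl ≫
          evalAt (A := .of R) (orbitUnionPoint h ≫ iter (orbitUnionMap h) j).left hj' =
          evalAt (A := .of R) (P ≫ iter φ j).left hj :=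
        stalkHom_comp_evalAt (A := .of R)
          (congrArg (fun f => f.left) (orbitUnionPoint_iter_comp h j)) _ _ _
      rw [← germ_evalAt_eq_zero_iff (A := .of R) (P ≫ iter φ j).left hj U hyU, ← e]
      exact hc' j j.2 hj'
    · have hempty : (P ≫ iter φ j).left ⁻¹ᵁ U = ⊥ := by
        rw [eq_bot_iff]
        intro t ht
        exact absurd ⟨t, rfl⟩ (Set.mem_iInter.mp (Set.mem_iInter.mp (hUO ht).2 j) hj)
      have : Subsingleton Γ((pt R).left, (P ≫ iter φ j).left ⁻¹ᵁ U) := by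
        rw [hempty]; infer_instance
      exact Subsingleton.elim _ _
  have happ : ι.app U f = 0 := by
    have : f ∈ RingHom.ker ((orbitIdeal φ P n).subschemeι.app U).hom := by
      rw [Scheme.IdealSheafData.ker_subschemeι_app (orbitIdeal φ P n) ⟨U, hU⟩]; exact hmem
    exact this
  have e := congrArg (fun q => q.hom f) (germ_stalkHom ι rfl U hyU)
  change (stalkHom ι rfl).hom (Z.left.presheaf.germ U (ι y) hyU f) =
    (orbitUnion φ P n).left.presheaf.germ (ι ⁻¹ᵁ U) y _ (ι.app U f) at e
  rw [e, happ, map_zero]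

end OrbitStalk

/-! ### The period of an orbit in terms of its cotangent space -/

section LocalPeriodOfPoint

variable {R : Type u} [CommRing R] [IsLocalRing R] {V : Over (Spec (.of R))}

theorem left_specialFibreι_pointOf {Ψ : V ⟶ V} {z : pt (ResidueField R) ⟶ (specialFibre R).obj V}
    (hz : z ≫ (specialFibre R).map Ψ = z) :
    Ψ.left (specialFibreι V (pointOf z)) = specialFibreι V (pointOf z) := by
  have e : specialFibreι V (((specialFibre R).map Ψ).left (pointOf z)) =
      Ψ.left (specialFibreι V (pointOf z)) :=
    congrArg (fun f => f (pointOf z)) (specialFibre_map_left_comp Ψ)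
  rw [← e, pointOf_comp _ hz]

theorem stalkHom_comp_stalkHom_specialFibreι {Ψ : V ⟶ V}
    {z : pt (ResidueField R) ⟶ (specialFibre R).obj V} (hz : z ≫ (specialFibre R).map Ψ = z)
    {y : V.left} (hy : specialFibreι V (pointOf z) = y) (hΨ : Ψ.left y = y) :
    stalkHom Ψ.left hΨ ≫ stalkHom (specialFibreι V) hy =
      stalkHom (specialFibreι V) hy ≫ localHom ((specialFibre R).map Ψ) hz := by
  apply stalk_hom_ext
  rw [localHom_eq_stalkHom, Spec.map_comp, Spec.map_comp, Category.assoc, Category.assoc,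
    specMap_stalkHom_fromSpecStalk, specMap_stalkHom_fromSpecStalk, ← Category.assoc,
    ← Category.assoc, specMap_stalkHom_fromSpecStalk, specMap_stalkHom_fromSpecStalk,
    Category.assoc, Category.assoc, specialFibre_map_left_comp]

theorem left_closedPoint_comp_iter {Ψ : V ⟶ V} {Q : pt R ⟶ V} {y : V.left}
    (hQ : Q.left (closedPoint R) = y) (hΨ : Ψ.left y = y) (i : ℕ) :
    (Q ≫ iter Ψ i).left (closedPoint R) = y := by
  induction i with
  | zero => rwa [iter_zero, Category.comp_id]
  | succ i ih =>
    rw [iter_succ, ← Category.assoc]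
    exact (congrArg Ψ.left ih).trans hΨ

/-- The `R`-algebra structure on a local ring of an `R`-scheme. -/
noncomputable abbrev stalkAlgebra (V : Over (Spec (.of R))) (y : V.left) :
    Algebra R (V.left.presheaf.stalk y) :=
  (stalkStructure V y).hom.toAlgebra

attribute [local instance] stalkAlgebra

/-- The endomorphism of the local ring at a fixed point. -/
noncomputable def stalkEnd (Ψ : V ⟶ V) {y : V.left} (hΨ : Ψ.left y = y) :
    V.left.presheaf.stalk y →ₐ[R] V.left.presheaf.stalk y where
  __ := (stalkHom Ψ.left hΨ).hom
  commutes' r := congrArg (fun q => q.hom r) (stalkStructure_comp_stalkHom Ψ hΨ)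

/-- The evaluation of the elements of a local ring at an `R`-valued point. -/
noncomputable def stalkEval (Q : pt R ⟶ V) {y : V.left} (hQ : Q.left (closedPoint R) = y) :
    V.left.presheaf.stalk y →ₐ[R] R where
  __ := (evalAt (A := .of R) Q.left hQ).hom
  commutes' r := congrArg (fun q => q.hom r) (stalkStructure_comp_evalAt Q hQ)

instance isLocalHom_stalkEval (Q : pt R ⟶ V) {y : V.left} (hQ : Q.left (closedPoint R) = y) :
    IsLocalHom (stalkEval Q hQ).toRingHom :=
  isLocalHom_evalAt (A := .of R) Q.left hQ

theorem stalkEval_congr {Q Q' : pt R ⟶ V} (e : Q = Q') {y : V.left}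
    (hQ : Q.left (closedPoint R) = y) (hQ' : Q'.left (closedPoint R) = y) :
    stalkEval Q hQ = stalkEval Q' hQ' := by
  subst e; rfl

theorem stalkEval_injective {Q Q' : pt R ⟶ V} {y : V.left}
    (hQ : Q.left (closedPoint R) = y) (hQ' : Q'.left (closedPoint R) = y)
    (e : stalkEval Q hQ = stalkEval Q' hQ') : Q = Q' := by
  have h : evalAt (A := .of R) Q.left hQ = evalAt (A := .of R) Q'.left hQ' := by
    ext c
    exact DFunLike.congr_fun e c
  ext1
  rw [← specMap_evalAt_fromSpecStalk (A := .of R) Q.left hQ, h, specMap_evalAt_fromSpecStalk]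

theorem stalkEval_comp_stalkEnd {Ψ : V ⟶ V} {Q : pt R ⟶ V} {y : V.left}
    (hQ : Q.left (closedPoint R) = y) (hΨ : Ψ.left y = y)
    (hQΨ : (Q ≫ Ψ).left (closedPoint R) = y) (c : V.left.presheaf.stalk y) :
    stalkEval Q hQ (stalkEnd Ψ hΨ c) = stalkEval (Q ≫ Ψ) hQΨ c := by
  have e : stalkHom Ψ.left hΨ ≫ evalAt (A := .of R) Q.left hQ =
      evalAt (A := .of R) (Q ≫ Ψ).left hQΨ :=
    stalkHom_comp_evalAt (A := .of R) (Over.comp_left _ _ _ Q Ψ).symm hΨ hQ hQΨ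
  exact congrArg (fun q => q.hom c) e

theorem stalkEval_stalkEnd_pow {Ψ : V ⟶ V} {Q : pt R ⟶ V} {y : V.left}
    (hQ : Q.left (closedPoint R) = y) (hΨ : Ψ.left y = y) (i : ℕ) (c : V.left.presheaf.stalk y) :
    stalkEval Q hQ ((stalkEnd Ψ hΨ ^ i) c) =
      stalkEval (Q ≫ iter Ψ i) (left_closedPoint_comp_iter hQ hΨ i) c := by
  induction i generalizing c with
  | zero =>
    rw [stalkEval_congr (show Q ≫ iter Ψ 0 = Q by rw [iter_zero, Category.comp_id]) _ hQ,
      pow_zero, AlgHom.one_apply]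
  | succ i ih =>
    have e : Q ≫ iter Ψ (i + 1) = (Q ≫ iter Ψ i) ≫ Ψ := by rw [iter_succ, Category.assoc]
    rw [pow_succ, AlgHom.mul_apply, ih,
      stalkEval_comp_stalkEnd _ _ (e ▸ left_closedPoint_comp_iter hQ hΨ (i + 1)),
      stalkEval_congr e]

/-- The primitive period of a point whose orbit lies in one residue class and separates the
elements of the local ring. -/
theorem period_eq_orderOf_cotangentMap_mul_pow [IsNoetherianRing R]
    {p : ℕ} (hp : p.Prime) [CharP (ResidueField R) p] {Ψ : V ⟶ V} {Q : pt R ⟶ V} {s : ℕ}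
    (hs : 0 < s) (hper : ∀ i, Q ≫ iter Ψ i = Q ↔ s ∣ i)
    (hΨ : reduction Q ≫ (specialFibre R).map Ψ = reduction Q)
    (hinj : ∀ {y : V.left} (_ : specialFibreι V (pointOf (reduction Q)) = y)
      (c : V.left.presheaf.stalk y),
      (∀ i (hi : (Q ≫ iter Ψ i).left (closedPoint R) = y), stalkEval (Q ≫ iter Ψ i) hi c = 0) →
        c = 0) :
    0 < orderOf (cotangentMap ((specialFibre R).map Ψ) hΨ :
        Module.End (ResidueField R) (CotangentAt (reduction Q))) ∧
      (∃ e, s = orderOf (cotangentMap ((specialFibre R).map Ψ) hΨ :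
        Module.End (ResidueField R) (CotangentAt (reduction Q))) * p ^ e) ∧
      (Subsingleton (CotangentAt (reduction Q)) → s = 1) := by
  obtain ⟨y, hy⟩ : ∃ y, specialFibreι V (pointOf (reduction Q)) = y := ⟨_, rfl⟩
  have hQy : Q.left (closedPoint R) = y := by rw [← hy, specialFibreι_pointOf_reduction]
  have hΨy : Ψ.left y = y := by rw [← hy, left_specialFibreι_pointOf hΨ]
  refine period_eq_orderOf_mapCotangent_mul_pow hp (stalkEnd Ψ hΨy) (stalkEval Q hQy) hs
    (fun c hc => hinj hy c fun i hi => ?_) (fun i => ?_)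
    (stalkHom (specialFibreι V) hy).hom
    (stalkHom_surjective (specialFibreι V) hy) (ker_stalkHom_specialFibreι_le _ hy)
    (fun r => congrArg (fun q => q.hom r) (stalkStructure_comp_stalkHom_specialFibreι _ hy))
    (localAlgHom ((specialFibre R).map Ψ) hΨ)
    (fun c => congrArg (fun q => q.hom c) (stalkHom_comp_stalkHom_specialFibreι hΨ hy hΨy))
    (maximalIdeal_le_comap _ hΨ)
  · rw [← hc i, stalkEval_stalkEnd_pow]
  · rw [← hper i]
    constructor
    · intro H
      refine stalkEval_injective (left_closedPoint_comp_iter hQy hΨy i) hQy ?_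
      ext c
      rw [← H c, stalkEval_stalkEnd_pow]
    · intro H c
      rw [stalkEval_stalkEnd_pow, stalkEval_congr H _ hQy]

end LocalPeriodOfPoint

section OrbitPeriod

variable {R : Type u} [CommRing R] {Z : Over (Spec (.of R))} {φ : Z ⟶ Z} {P : pt R ⟶ Z} {n m : ℕ}

theorem orbitUnionPoint_comp_iter_eq_iff (h : IsPrimitivePeriod φ P n) (j : ℕ) :
    orbitUnionPoint h ≫ iter (orbitUnionMap h) j = orbitUnionPoint h ↔ n ∣ j := by
  have : Mono (orbitUnionι φ P n).left :=
    inferInstanceAs (Mono (orbitIdeal φ P n).subschemeι)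
  have : Mono (orbitUnionι φ P n) := Over.mono_of_mono_left _
  rw [← cancel_mono (orbitUnionι φ P n), orbitUnionPoint_iter_comp, orbitUnionPoint_comp,
    h.comp_iter_eq_iff]

variable [IsLocalRing R]

theorem reduction_comp_iter (φ : Z ⟶ Z) (P : pt R ⟶ Z) (j : ℕ) :
    reduction P ≫ iter ((specialFibre R).map φ) j = reduction (P ≫ iter φ j) := by
  rw [← map_iter, reduction_comp]

theorem IsPrimitivePeriod.dvd_of_reduction (h : IsPrimitivePeriod φ P n)
    (hm : IsPrimitivePeriod ((specialFibre R).map φ) (reduction P) m) : m ∣ n := by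
  rw [← hm.comp_iter_eq_iff, reduction_comp_iter, h.1.2]

/-- The points of the orbit in the residue class of `P` are the `φ ^ j (P)` with `m ∣ j`. -/
theorem dvd_of_closedPoint_eq (h : IsPrimitivePeriod φ P n)
    (hm : IsPrimitivePeriod ((specialFibre R).map φ) (reduction P) m) {j : ℕ}
    (hj : (orbitUnionPoint h ≫ iter (orbitUnionMap h) j).left (closedPoint R) =
      (orbitUnionPoint h).left (closedPoint R)) : m ∣ j := by
  rw [← hm.comp_iter_eq_iff, reduction_comp_iter]
  apply reduction_eq_of_closedPoint_eq
  have e₁ : (P ≫ iter φ j).left (closedPoint R) = (orbitUnionι φ P n).left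
      ((orbitUnionPoint h ≫ iter (orbitUnionMap h) j).left (closedPoint R)) :=
    congrArg (fun f => f.left (closedPoint R)) (orbitUnionPoint_iter_comp h j).symm
  have e₂ : (orbitUnionι φ P n).left ((orbitUnionPoint h).left (closedPoint R)) =
      P.left (closedPoint R) :=
    congrArg (fun f => f.left (closedPoint R)) (orbitUnionPoint_comp h)
  rw [e₁, hj, e₂]

theorem orbitDifferential_eq_cotangentMap (h : IsPrimitivePeriod φ P n)
    (hm : IsPrimitivePeriod ((specialFibre R).map φ) (reduction P) m)
    (hz : reduction (orbitUnionPoint h) ≫ (specialFibre R).map (iter (orbitUnionMap h) m) =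
      reduction (orbitUnionPoint h)) :
    orbitDifferential h hm = cotangentMap _ hz := by
  have e := map_iter (specialFibre R) (orbitUnionMap h) m
  revert hz
  rw [e]
  intro _
  rfl

/-- The quotient `n / m` of the primitive periods is the order of the endomorphism of the
cotangent space of the scheme-theoretic union of the orbit up to a power of `p`. -/
theorem period_eq_mul_orderOf_orbitDifferential_mul_pow [IsNoetherianRing R] [IsSeparated Z.hom]
    {p : ℕ} (hp : p.Prime) [CharP (ResidueField R) p] (h : IsPrimitivePeriod φ P n)
    (hm : IsPrimitivePeriod ((specialFibre R).map φ) (reduction P) m) :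
    0 < orderOf (orbitDifferential h hm) ∧
      (∃ e, n = m * orderOf (orbitDifferential h hm) * p ^ e) ∧
      (Subsingleton (CotangentAt (reduction (orbitUnionPoint h))) → n = m) := by
  obtain ⟨s, hs⟩ := h.dvd_of_reduction hm
  have hs0 : 0 < s := Nat.pos_of_ne_zero fun h0 => h.1.1.ne' (by rw [hs, h0, mul_zero])
  have hz : reduction (orbitUnionPoint h) ≫ (specialFibre R).map (iter (orbitUnionMap h) m) =
      reduction (orbitUnionPoint h) := by
    rw [map_iter, reduction_orbitUnionPoint_iter h hm]
  obtain ⟨hpos, ⟨e, he⟩, hsub⟩ := period_eq_orderOf_cotangentMap_mul_pow hp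
    (Ψ := iter (orbitUnionMap h) m) (Q := orbitUnionPoint h) hs0
    (fun i => by
      rw [← iter_mul, orbitUnionPoint_comp_iter_eq_iff, hs, Nat.mul_dvd_mul_iff_left hm.1.1]) hz
    (fun {y} hy c hc => by
      refine eq_zero_of_forall_evalAt_eq_zero h
        (hy ▸ hom_specialFibreι_pointOf (reduction (orbitUnionPoint h))) c fun j _ hj => ?_
      obtain ⟨i, rfl⟩ := dvd_of_closedPoint_eq h hm
        (hj.trans (hy.symm.trans (specialFibreι_pointOf_reduction (orbitUnionPoint h))))
      have e : orbitUnionPoint h ≫ iter (orbitUnionMap h) (m * i) =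
          orbitUnionPoint h ≫ iter (iter (orbitUnionMap h) m) i := by rw [iter_mul]
      have hj' : (orbitUnionPoint h ≫ iter (iter (orbitUnionMap h) m) i).left (closedPoint R) = y :=
        e ▸ hj
      exact (DFunLike.congr_fun (stalkEval_congr e hj hj') c).trans (hc i hj'))
  rw [← orbitDifferential_eq_cotangentMap h hm hz] at hpos he
  exact ⟨hpos, ⟨e, by rw [mul_assoc, ← he, hs]⟩, fun hS => by rw [hs, hsub hS, mul_one]⟩

/-- The restriction of cotangent vectors to the union of the orbit is surjective, as it comes from
a closed immersion. -/
theorem orbitRestriction_surjective (h : IsPrimitivePeriod φ P n) :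
    Function.Surjective (orbitRestriction h) := by
  have hcl : IsClosedImmersion ((specialFibre R).map (orbitUnionι φ P n)).left := by
    have hc : IsClosedImmersion (((specialFibre R).map (orbitUnionι φ P n)).left ≫
        specialFibreι Z) := by
      rw [specialFibre_map_left_comp]
      have : IsClosedImmersion (specialFibreι (orbitUnion φ P n)) := inferInstance
      infer_instance
    exact MorphismProperty.of_postcomp @IsClosedImmersion (W' := @IsSeparated) _ (specialFibreι Z)
      inferInstance hc
  set g := (specialFibre R).map (orbitUnionι φ P n) with hg
  intro v
  obtain ⟨⟨a, ha⟩, rfl⟩ := (maximalIdeal _).toCotangent_surjective v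
  have hsurj : Function.Surjective (localHom g (reduction_orbitUnionPoint_comp h)).hom :=
    stalkHom_surjective g.left (pointOf_comp g (reduction_orbitUnionPoint_comp h))
  have hloc : IsLocalHom (localHom g (reduction_orbitUnionPoint_comp h)).hom :=
    isLocalHom_stalkHom g.left (pointOf_comp g (reduction_orbitUnionPoint_comp h))
  obtain ⟨b, rfl⟩ := hsurj a
  have hb : b ∈ maximalIdeal (localRing (reduction P)) := fun hu => ha (hu.map _)
  exact ⟨(maximalIdeal _).toCotangent ⟨b, hb⟩, rfl⟩

theorem cotangentMap_comp {k : Type u} [Field k] {X Y W : Over (Spec (.of k))} {x : pt k ⟶ X}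
    {y : pt k ⟶ Y} {w : pt k ⟶ W} (f : X ⟶ Y) (g : Y ⟶ W) (hf : x ≫ f = y) (hg : y ≫ g = w)
    (hfg : x ≫ f ≫ g = w) :
    cotangentMap (f ≫ g) hfg = cotangentMap f hf ∘ₗ cotangentMap g hg := by
  have e : localHom (f ≫ g) hfg = localHom g hg ≫ localHom f hf := by
    apply stalk_hom_ext
    rw [localHom_eq_stalkHom, localHom_eq_stalkHom, localHom_eq_stalkHom, Spec.map_comp,
      Category.assoc, specMap_stalkHom_fromSpecStalk, specMap_stalkHom_fromSpecStalk,
      ← Category.assoc, specMap_stalkHom_fromSpecStalk, Category.assoc, Over.comp_left]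
  ext v
  obtain ⟨a, rfl⟩ := (maximalIdeal _).toCotangent_surjective v
  refine congrArg (maximalIdeal (localRing x)).toCotangent (Subtype.ext ?_)
  exact congrArg (fun q => q.hom a.1) e

theorem cotangentMap_congr {k : Type u} [Field k] {X Y : Over (Spec (.of k))} {x : pt k ⟶ X}
    {y : pt k ⟶ Y} {f g : X ⟶ Y} (e : f = g) (hf : x ≫ f = y) (hg : x ≫ g = y) :
    cotangentMap f hf = cotangentMap g hg := by
  subst e; rfl

theorem orbitRestriction_comp_reducedDifferential (h : IsPrimitivePeriod φ P n)
    (hm : IsPrimitivePeriod ((specialFibre R).map φ) (reduction P) m) :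
    orbitRestriction h ∘ₗ reducedDifferential hm =
      orbitDifferential h hm ∘ₗ orbitRestriction h := by
  have c : (specialFibre R).map (orbitUnionι φ P n) ≫ iter ((specialFibre R).map φ) m =
      iter ((specialFibre R).map (orbitUnionMap h)) m ≫
        (specialFibre R).map (orbitUnionι φ P n) := by
    refine iter_comp_of_comm ?_ m
    rw [← Functor.map_comp, ← Functor.map_comp, orbitUnionι_comp h]
  have h₁ : reduction (orbitUnionPoint h) ≫ (specialFibre R).map (orbitUnionι φ P n) ≫
      iter ((specialFibre R).map φ) m = reduction P := by
    rw [← Category.assoc, reduction_orbitUnionPoint_comp, hm.1.2]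
  rw [orbitRestriction, reducedDifferential, orbitDifferential,
    ← cotangentMap_comp _ _ _ _ h₁, ← cotangentMap_comp _ _ _ _ (c ▸ h₁)]
  exact cotangentMap_congr c _ _

end OrbitPeriod

/-! ### The relative dimension of a smooth scheme at a point of the special fibre -/

section RelativeDimension

variable {R : Type u} [CommRing R]

/-- A smooth scheme over a local ring is covered, near its special fibre, by affine open subschemes
which are standard smooth over the whole base. -/
theorem exists_isStandardSmoothOfRelativeDimension [IsLocalRing R] (Z : Over (Spec (.of R)))
    [Smooth Z.hom] {x : Z.left} (hx : Z.hom x = closedPoint R) :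
    ∃ (V : Z.left.Opens) (hV : IsAffineOpen V) (_ : x ∈ V) (ρ : CommRingCat.of R ⟶ Γ(Z.left, V))
      (δ : ℕ), ρ.hom.IsStandardSmoothOfRelativeDimension δ ∧
        Spec.map ρ = hV.fromSpec ≫ Z.hom := by
  obtain ⟨U, hU, V, hV, hxV, e, h⟩ := Smooth.exists_isStandardSmooth Z.hom x
  -- The closed point of a local scheme lies in no proper open subset.
  obtain rfl : U = ⊤ := IsLocalRing.closed_point_mem_iff.mp (hx ▸ e hxV)
  let ρ : CommRingCat.of R ⟶ Γ(Z.left, V) :=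
    (Scheme.ΓSpecIso (.of R)).inv ≫ Z.hom.appLE ⊤ V e
  have hρ : ρ.hom.IsStandardSmooth :=
    RingHom.isStandardSmooth_respectsIso.2 _
      (Scheme.ΓSpecIso (.of R)).symm.commRingCatIsoToRingEquiv h
  refine ⟨V, hV, hxV, ρ, ?_⟩
  let _ : Algebra R Γ(Z.left, V) := ρ.hom.toAlgebra
  obtain ⟨ι, σ, _, _, ⟨Q⟩⟩ := hρ.toAlgebra.out
  refine ⟨Q.dimension, Q.isStandardSmoothOfRelativeDimension rfl, ?_⟩
  rw [Spec.map_comp, ← hU.SpecMap_appLE_fromSpec Z.hom hV e]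
  congr 1
  exact (IsAffineOpen.fromSpec_top.trans (Scheme.isoSpec_Spec_inv _)).symm

theorem stalkStructure_eq_comp_germ (Z : Over (Spec (.of R))) {V : Z.left.Opens}
    (hV : IsAffineOpen V) {ρ : CommRingCat.of R ⟶ Γ(Z.left, V)}
    (hρ : Spec.map ρ = hV.fromSpec ≫ Z.hom) {x : Z.left} (hx : x ∈ V) :
    stalkStructure Z x = ρ ≫ Z.left.presheaf.germ V x hx := by
  apply Spec.map_injective
  rw [specMap_stalkStructure, Spec.map_comp, hρ, ← Category.assoc,
    ← hV.fromSpecStalk_eq_fromSpecStalk hx, IsAffineOpen.fromSpecStalk]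

/-- The generic fibre has dimension at least the relative dimension of a standard smooth chart with
an integral point: the chart becomes an open subscheme of the generic fibre with a rational
point. -/
theorem le_topologicalKrullDim_genericFibre {K : Type u} [Field K] [Algebra R K]
    (Z : Over (Spec (.of R))) {V : Z.left.Opens} (hV : IsAffineOpen V)
    {ρ : CommRingCat.of R ⟶ Γ(Z.left, V)} (hρ : Spec.map ρ = hV.fromSpec ≫ Z.hom) (δ : ℕ)
    (hδ : ρ.hom.IsStandardSmoothOfRelativeDimension δ) (ev : Γ(Z.left, V) →+* R)
    (hev : ∀ r, ev (ρ r) = r) :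
    (δ : WithBot ℕ∞) ≤ topologicalKrullDim ((genericFibre R K).obj Z).left := by
  let S : Type u := Γ(Z.left, V)
  let _ : Algebra R S := ρ.hom.toAlgebra
  have : Algebra.IsStandardSmoothOfRelativeDimension δ R S := hδ
  let ev' : S →ₐ[R] K := { (algebraMap R K).comp ev with
    commutes' := fun r => congrArg (algebraMap R K) (hev r) }
  let f : TensorProduct R K S →ₐ[K] K :=
    Algebra.TensorProduct.lift (AlgHom.id K K) ev' fun _ _ => .all _ _
  refine (le_ringKrullDim_of_isStandardSmooth δ f).trans ?_
  have big : IsPullback _ _ (hV.fromSpec ≫ Z.hom)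
      (Spec.map (CommRingCat.ofHom (algebraMap R K))) :=
    hρ ▸ (isPullback_SpecMap_of_isPushout _ _ _ _
      (CommRingCat.isPushout_tensorProduct R K S)).flip
  -- The chart of the generic fibre is the base change of the open immersion of the chart of `Z`.
  have sq := IsPullback.of_bot' big (IsPullback.of_hasPullback Z.hom _)
  have hw := MorphismProperty.of_isPullback (P := @IsOpenImmersion) sq inferInstance
  rw [← PrimeSpectrum.topologicalKrullDim_eq_ringKrullDim]
  exact (Scheme.Hom.isOpenEmbedding _ (H := hw)).isInducing.topologicalKrullDim_le

variable [IsLocalRing R]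

/-- The cotangent space of the special fibre at an integral point has dimension at most the
relative dimension of a standard smooth chart around the point. -/
theorem finrank_cotangentAt_reduction_le {Z : Over (Spec (.of R))} (P : pt R ⟶ Z)
    {V : Z.left.Opens} (hV : IsAffineOpen V) (hP : P.left (closedPoint R) ∈ V)
    {ρ : CommRingCat.of R ⟶ Γ(Z.left, V)} (hρ : Spec.map ρ = hV.fromSpec ≫ Z.hom) (δ : ℕ)
    (hδ : ρ.hom.IsStandardSmoothOfRelativeDimension δ) :
    FiniteDimensional (ResidueField R) (CotangentAt (reduction P)) ∧
      Module.finrank (ResidueField R) (CotangentAt (reduction P)) ≤ δ := by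
  let S : Type u := Γ(Z.left, V)
  let _ : Algebra R S := ρ.hom.toAlgebra
  have : Algebra.IsStandardSmoothOfRelativeDimension δ R S := hδ
  set y := P.left (closedPoint R) with hy
  set q := stalkHom (specialFibreι Z) (specialFibreι_pointOf_reduction P) with hq
  let γ : S →+* Z.left.presheaf.stalk y := (Z.left.presheaf.germ V y hP).hom
  let ev : Z.left.presheaf.stalk y →+* R := (evalAt (A := .of R) P.left hy.symm).hom
  have hγ : ∀ r : R, γ (algebraMap R S r) = (stalkStructure Z y).hom r := fun r =>
    (congrArg (fun f => f.hom r) (stalkStructure_eq_comp_germ Z hV hρ hP)).symm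
  have hev : ∀ r : R, ev ((stalkStructure Z y).hom r) = r := fun r =>
    congrArg (fun f => f.hom r) (stalkStructure_comp_evalAt P hy.symm)
  have hqs : ∀ r : R, q.hom ((stalkStructure Z y).hom r) =
      algebraMap (ResidueField R) (localRing (reduction P)) (residue R r) := fun r =>
    congrArg (fun f => f.hom r) (stalkStructure_comp_stalkHom_specialFibreι (reduction P)
      (specialFibreι_pointOf_reduction P))
  have : Nontrivial S := RingHom.domain_nontrivial γ
  have hloc : IsLocalHom q.hom := isLocalHom_stalkHom _ _
  refine finrank_cotangent_le_of_isStandardSmooth δ (A := localRing (reduction P))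
    (q.hom.comp γ) (fun r => ?_) (fun a => ?_) ((residue R).comp (ev.comp γ)) (fun r => ?_)
    fun c => ?_
  · rw [RingHom.comp_apply, hγ, hqs]
  · obtain ⟨b, rfl⟩ := stalkHom_surjective (specialFibreι Z) (specialFibreι_pointOf_reduction P) a
    let _ : Algebra Γ(Z.left, V) (Z.left.presheaf.stalk y) := γ.toAlgebra
    have : IsLocalization.AtPrime (Z.left.presheaf.stalk y) (hV.primeIdealOf ⟨y, hP⟩).asIdeal :=
      hV.isLocalization_stalk ⟨y, hP⟩
    obtain ⟨⟨s, t⟩, hst⟩ := IsLocalization.surj (hV.primeIdealOf ⟨y, hP⟩).asIdeal.primeCompl b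
    refine ⟨s, t, (IsLocalization.map_units (Z.left.presheaf.stalk y) t).map q.hom, ?_⟩
    exact (map_mul q.hom b (γ t)).symm.trans (congrArg q.hom hst)
  · rw [RingHom.comp_apply, RingHom.comp_apply, hγ, hev]
  · change q.hom (γ c) - algebraMap _ _ (residue R (ev (γ c))) ∈ _
    rw [← hqs, ← map_sub]
    intro hu
    have h0 := (hloc.map_nonunit _ hu).map ev
    rw [map_sub, hev, sub_self] at h0
    exact not_isUnit_zero h0

end RelativeDimension

/-! ### The period formula -/

instance isSeparated_projectiveSpace_hom (A : Type u) [CommRing A] (N : ℕ) :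
    IsSeparated (projectiveSpace A N).hom := by
  unfold projectiveSpace
  dsimp only [Over.mk_hom]
  infer_instance

/-- The dimension of the cotangent space of the special fibre of a smooth scheme at an integral
point is at most the dimension of the generic fibre. -/
theorem finrank_cotangentAt_reduction_le_of_topologicalKrullDim {R : Type u} [CommRing R]
    [IsLocalRing R] {K : Type u} [Field K] [Algebra R K] {Z : Over (Spec (.of R))} [Smooth Z.hom]
    {d : ℕ} (hd : topologicalKrullDim ((genericFibre R K).obj Z).left = d) (P : pt R ⟶ Z) :
    FiniteDimensional (ResidueField R) (CotangentAt (reduction P)) ∧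
      Module.finrank (ResidueField R) (CotangentAt (reduction P)) ≤ d := by
  have hx : Z.hom (P.left (closedPoint R)) = closedPoint R :=
    congrArg (fun f => f (closedPoint R)) (Over.w P)
  obtain ⟨V, hV, hP, ρ, δ, hδ, hρ⟩ := exists_isStandardSmoothOfRelativeDimension Z hx
  obtain ⟨h₁, h₂⟩ := finrank_cotangentAt_reduction_le P hV hP hρ δ hδ
  refine ⟨h₁, h₂.trans ?_⟩
  have h₃ := le_topologicalKrullDim_genericFibre (K := K) Z hV hρ δ hδ
    ((evalAt (A := .of R) P.left rfl).hom.comp (Z.left.presheaf.germ V _ hP).hom) fun r => by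
      have e := stalkStructure_comp_evalAt P rfl
      rw [stalkStructure_eq_comp_germ Z hV hρ hP] at e
      exact congrArg (fun f => f.hom r) e
  rw [hd] at h₃
  exact_mod_cast h₃

end PeriodicReduction

theorem mainTheorem1 {R : Type u} [CommRing R] [IsDomain R] [IsDiscreteValuationRing R]
    [IsAdicComplete (maximalIdeal R) R] [Finite (ResidueField R)]
    {K : Type u} [Field K] [Algebra R K] [IsFractionRing R K]
    (p : ℕ) [CharP (ResidueField R) p] {N d : ℕ}
    (𝒳 : Over (Spec (.of R))) (ι : 𝒳 ⟶ projectiveSpace R N) [IsClosedImmersion ι.left]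
    [Smooth 𝒳.hom]
    [IrreducibleSpace ((genericFibre R K).obj 𝒳).left]
    (hd : topologicalKrullDim ((genericFibre R K).obj 𝒳).left = d)
    (φ : 𝒳 ⟶ 𝒳) (P : pt R ⟶ 𝒳) (n m : ℕ)
    (hn : IsPrimitivePeriod φ P n)
    (hm : IsPrimitivePeriod ((specialFibre R).map φ) (reduction P) m) :
    n = m ∨
      (Function.Surjective (orbitRestriction hn) ∧
        orbitRestriction hn ∘ₗ reducedDifferential hm =
          orbitDifferential hn hm ∘ₗ orbitRestriction hn) ∧
      ∃ (V : Submodule (ResidueField R) (CotangentAt (reduction P)))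
        (hV : ∀ v ∈ V, reducedDifferential hm v ∈ V)
        (θ : V ≃ₗ[ResidueField R] CotangentAt (reduction (orbitUnionPoint hn))) (e : ℕ),
        (∀ v, θ ((reducedDifferential hm).restrict hV v) = orbitDifferential hn hm (θ v)) ∧
        n = m * orderOf (G := Module.End (ResidueField R) V)
          ((reducedDifferential hm).restrict hV) * p ^ e ∧
        Module.finrank (ResidueField R) V ≤ d ∧
        orderOf (G := Module.End (ResidueField R) V) ((reducedDifferential hm).restrict hV) ≤
          Nat.card (ResidueField R) ^ Module.finrank (ResidueField R) V - 1 := by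
  have hsep : IsSeparated 𝒳.hom := by
    rw [← Over.w ι]
    infer_instance
  have hp : p.Prime := (CharP.char_is_prime_or_zero (ResidueField R) p).resolve_right
    (CharP.char_ne_zero_of_finite (ResidueField R) p)
  obtain ⟨hpos, ⟨e, he⟩, hsub⟩ := period_eq_mul_orderOf_orbitDifferential_mul_pow hp hn hm
  refine or_iff_not_imp_left.mpr fun hnm => ?_
  have : Nontrivial (CotangentAt (reduction (orbitUnionPoint hn))) :=
    not_subsingleton_iff_nontrivial.mp fun hS => hnm (hsub hS)
  obtain ⟨hfd, hle⟩ := finrank_cotangentAt_reduction_le_of_topologicalKrullDim hd P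
  have hsurj := orbitRestriction_surjective hn
  have hcomm := orbitRestriction_comp_reducedDifferential hn hm
  obtain ⟨V, hV, θ, hθ⟩ := exists_stable_submodule_equiv_quotient (reducedDifferential hm)
    (orbitDifferential hn hm) (orbitRestriction hn) hsurj hcomm
  have hord := orderOf_eq_of_linearEquiv θ hθ
  have : Nontrivial V := θ.toEquiv.nontrivial
  refine ⟨⟨hsurj, hcomm⟩, V, hV, θ, e, hθ, by rw [hord]; exact he,
    (Submodule.finrank_le V).trans hle, orderOf_end_le _ (hord ▸ hpos)⟩
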